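/- Let $P$ be a simple polygon in the plane with vertices $v_0,\dots,v_{n-1}$ ($n\ge 3$, indices modulo $n$), edges $e_i=v_iv_{i+1}$. Assume that no vertex angle is acute, i.e. $\angle v_{i-1}v_iv_{i+1}\ge \pi/2$ for all $i$, and that no three vertices define a right angle, i.e. $\angle v_iv_jv_k\ne\pi/2$ for all pairwise distinct $i,j,k$. Parametrize $P$ by arc length from $v_0$ as a closed curve $P\colon S^1\to\mathbb{R}^2$ (the position of the human). Describe the puppy by a continuous position $\pi\colon S^1\to\mathbb{R}^2$ and a continuous unit direction $\theta\colon S^1\to S^1$: as the parameter increases, the puppy alternately traverses an edge $e_i$ at unit speed, with $\theta$ constant and equal to the direction of $e_i$, and rests at $v_{i+1}$ while $\theta$ turns at unit angular speed through the exterior angle (in $(-\pi,\pi)$) from the direction of $e_i$ to that of $e_{i+1}$. The attraction diagram of $P$ is the set of critical configurations $$\{(x,y)\in S^1\times S^1 \mid (P(x)-\pi(y))\cdot\theta(y)=0\}.$$ Its connected components are called critical cycles. A simple closed curve on the torus $S^1\times S^1$ is called contractible if it is null-homotopic (equivalently, if it is the boundary of a simply connected open subset of the torus), and essential otherwise. Then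 every critical cycle is a simple closed curve, so that the attraction diagram is a union of pairwise disjoint simple closed curves, and exactly two of the critical cycles are essential. -/

import Mathlib

/-- A simple polygon in the plane `ℂ = ℝ²`: at least three, pairwise distinct vertices, and two
different edges meet at most in a common endpoint. Edge `i` joins vertex `i` to vertex `i + 1`,
with indices modulo `n`. -/
structure SimplePolygon (n : ℕ) [NeZero n] extends Polygon ℂ n where
  three_le : 3 ≤ n
  vertices_injective : Function.Injective vertices
  edges_inter : ∀ i j : Fin n, i ≠ j →
    segment ℝ (vertices i) (vertices (i + 1)) ∩ segment ℝ (vertices j) (vertices (j + 1)) ⊆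
      {vertices i, vertices (i + 1)} ∩ {vertices j, vertices (j + 1)}

namespace SimplePolygon

variable {n : ℕ} [NeZero n] (P : SimplePolygon n)

/-- The angle at vertex `i` between the two incident edges; it lies in `[0, π]`. -/
noncomputable def vertexAngle (i : Fin n) : ℝ :=
  EuclideanGeometry.angle (P.vertices (i - 1)) (P.vertices i) (P.vertices (i + 1))

/-- No vertex angle is (strictly) acute. -/
def NoAcuteVertexAngle : Prop :=
  ∀ i : Fin n, Real.pi / 2 ≤ P.vertexAngle i

/-- No three distinct vertices of the polygon, consecutive or not, define a right angle. -/
def NoRightAngle : Prop :=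
  ∀ i j k : Fin n, i ≠ j → j ≠ k → i ≠ k →
    EuclideanGeometry.angle (P.vertices i) (P.vertices j) (P.vertices k) ≠ Real.pi / 2

/-- The vector along edge `i`. -/
noncomputable def edgeVec (i : Fin n) : ℂ := P.vertices (i + 1) - P.vertices i

/-- The length of edge `i`. -/
noncomputable def edgeLength (i : Fin n) : ℝ := ‖P.edgeVec i‖

/-- The unit vector along edge `i`. -/
noncomputable def edgeDir (i : Fin n) : ℂ := P.edgeVec i / (P.edgeLength i : ℂ)

/-- The signed exterior angle at vertex `i + 1`, by which the direction turns (counterclockwise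
if positive) from edge `i` to edge `i + 1`. -/
noncomputable def turn (i : Fin n) : ℝ := Complex.arg (P.edgeVec (i + 1) / P.edgeVec i)

/-- The length of the human's circle: the perimeter of the polygon. -/
noncomputable def perimeter : ℝ := ∑ i, P.edgeLength i

/-- The length of the puppy's circle: the perimeter plus the total absolute turning angle. -/
noncomputable def puppyPeriod : ℝ := ∑ i, (P.edgeLength i + |P.turn i|)

theorem edgeLength_pos (i : Fin n) : 0 < P.edgeLength i := by
  have h3 := P.three_le
  refine norm_pos_iff.2 (sub_ne_zero.2 fun h => ?_)
  have h1 := P.vertices_injective h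
  have h2 : (1 : Fin n) = 0 := by simpa using h1
  have h4 := congrArg Fin.val h2
  rw [Fin.val_one', Fin.val_zero, Nat.mod_eq_of_lt (by omega)] at h4
  exact one_ne_zero h4

instance perimeter_pos : Fact (0 < P.perimeter) :=
  ⟨Finset.sum_pos (fun i _ => P.edgeLength_pos i) ⟨0, Finset.mem_univ _⟩⟩

instance puppyPeriod_pos : Fact (0 < P.puppyPeriod) :=
  ⟨Finset.sum_pos (fun i _ => add_pos_of_pos_of_nonneg (P.edgeLength_pos i) (abs_nonneg _))
    ⟨0, Finset.mem_univ _⟩⟩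

/-- `ramp a d t` is the part of the time interval `[a, a + d]` that has elapsed at time `t`. -/
noncomputable def ramp (a d t : ℝ) : ℝ := max 0 (min d (t - a))

/-- The parameter at which the human, walking at unit speed from vertex `0`, enters edge `i`. -/
noncomputable def humanStart (i : Fin n) : ℝ := ∑ k ∈ Finset.Iio i, P.edgeLength k

/-- The parameter at which the puppy enters edge `i`. The puppy starts on edge `0`, moves at unit
speed along edges, and turns at unit angular speed at vertices. -/
noncomputable def puppyStart (i : Fin n) : ℝ :=
  ∑ k ∈ Finset.Iio i, (P.edgeLength k + |P.turn k|)

/-- The track: the polygon parametrized by arc length, starting at vertex `0`. -/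
noncomputable def track : AddCircle P.perimeter → ℂ :=
  AddCircle.liftIco P.perimeter 0 fun t =>
    P.vertices 0 + ∑ i, (ramp (P.humanStart i) (P.edgeLength i) t : ℂ) * P.edgeDir i

/-- The puppy's position: it runs along edge `i` from parameter `puppyStart i` on for a time
`edgeLength i`, and then rests at vertex `i + 1` for a time `|turn i|`. -/
noncomputable def puppyPos : AddCircle P.puppyPeriod → ℂ :=
  AddCircle.liftIco P.puppyPeriod 0 fun t =>
    P.vertices 0 + ∑ i, (ramp (P.puppyStart i) (P.edgeLength i) t : ℂ) * P.edgeDir i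

/-- The puppy's direction, a unit vector: it is constant along edges, and at vertex `i + 1` it
rotates at unit angular speed through the exterior angle `turn i`. -/
noncomputable def puppyDir : AddCircle P.puppyPeriod → ℂ :=
  AddCircle.liftIco P.puppyPeriod 0 fun t =>
    P.edgeDir 0 * Complex.exp (Complex.I *
      ∑ i, (SignType.sign (P.turn i) *
        ramp (P.puppyStart i + P.edgeLength i) |P.turn i| t : ℝ))

/-- The configuration torus: pairs of a human parameter and a puppy parameter. -/
abbrev Torus : Type := AddCircle P.perimeter × AddCircle P.puppyPeriod

/-- The attraction diagram: the set of critical configurations `(x, y)`, those for which the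
vector from puppy to human is orthogonal to the puppy's direction. -/
def attractionDiagram : Set P.Torus :=
  {c | inner ℝ (P.track c.1 - P.puppyPos c.2) (P.puppyDir c.2) = 0}

/-- The critical cycles: the connected components of the attraction diagram. -/
def IsCriticalCycle (C : Set P.Torus) : Prop :=
  ∃ c ∈ P.attractionDiagram, C = connectedComponentIn P.attractionDiagram c

end SimplePolygon

/-- A simple closed curve: the image of a circle under an injective continuous map. -/
def IsSimpleClosedCurve {X : Type*} [TopologicalSpace X] (C : Set X) : Prop :=
  ∃ γ : C(Circle, X), Function.Injective γ ∧ Set.range γ = C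

/-- A simple closed curve is essential if it is not contractible, that is, if no injective
parametrization of it by a circle is homotopic to a constant map. (On a torus, a simple closed
curve is null-homotopic if and only if it is the boundary of a simply connected open subset.) -/
def IsEssentialCurve {X : Type*} [TopologicalSpace X] (C : Set X) : Prop :=
  IsSimpleClosedCurve C ∧
    ∀ γ : C(Circle, X), Function.Injective γ → Set.range γ = C → ¬ γ.Nullhomotopic

/-! Write F(x, y) = (P(x) − π(y))·θ(y). A vertex angle is π minus the absolute exterior angle, so
the two angle hypotheses make every turn strictly smaller than π/2. Hence F > 0 when the human is
slightly ahead of the puppy and F < 0 when slightly behind (`critFun_ahead`, `critFun_behind`). The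
diagonal, where puppy and human coincide, is therefore isolated in the zero set of F. It is a graph
over the puppy's circle, so it is an essential simple closed curve.

Off the diagonal the zero set is locally an arc (`SimplePolygon.hasArcAt`). While the puppy walks, F
is strictly monotone in y; while it turns, F is locally injective in y near a zero. At the instants
between walking and turning, the absence of right angles keeps the human away from vertices and off
edges orthogonal to θ, so F is strictly monotone in x. A component is then a compact connected
one-manifold, that is, a circle (`LocallyArc.exists_circle`).

Winding is measured by the nonexistence of a continuous logarithm, a homotopy invariant
(`HasLog.of_preconnected`). Off the diagonal x and y wind together, so a cycle is essential exactly
when y has no logarithm along it (`isEssentialCurve_iff`).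

Existence of a second essential cycle: cut the torus along a strip around the diagonal, which leaves
an annulus with F > 0 on one boundary circle and F < 0 on the other. If y had a logarithm on every
other cycle, the logarithms would glue and extend to the annulus by Tietze. Taking the exponential
of the extension where F ≥ 0 and y itself where F < 0 gives a nonvanishing function with a logarithm
on one boundary circle and none on the other, which is impossible.

Uniqueness: a point of the polygon farthest from the origin is never strictly between two other
points of it. With the puppy at such a point, two essential cycles C, C' must have the human on the
same side. Suppose C comes closest to the puppy. Distinct cycles never have the same puppy parameter
and the same distance, so 1 − e^d·u does not vanish on C × C', where d is the difference of the
distances and u the difference of the puppy parameters on the unit circle. Fixing in C a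
configuration with the human at the farthest point, this function has a logarithm along C'; fixing
the closest configuration, it winds like −u. The two slices are joined through C, a contradiction
(`false_of_offset_le`). -/

section

/-! ### Continuous logarithms as a substitute for winding numbers. -/

open Complex Topology Filter Set

/-- A complex valued function has a continuous logarithm. -/
def HasLog {K : Type*} [TopologicalSpace K] (f : K → ℂ) : Prop :=
  ∃ g : K → ℂ, Continuous g ∧ ∀ k, Complex.exp (g k) = f k

namespace HasLog

variable {K K' : Type*} [TopologicalSpace K] [TopologicalSpace K'] {f g : K → ℂ}

theorem const {a : ℂ} (ha : a ≠ 0) : HasLog fun _ : K => a :=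
  ⟨fun _ => Complex.log a, continuous_const, fun _ => Complex.exp_log ha⟩

theorem mul (hf : HasLog f) (hg : HasLog g) : HasLog fun k => f k * g k := by
  obtain ⟨F, hF, hF'⟩ := hf
  obtain ⟨G, hG, hG'⟩ := hg
  exact ⟨fun k => F k + G k, hF.add hG, fun k => by rw [Complex.exp_add, hF', hG']⟩

theorem inv (hf : HasLog f) : HasLog fun k => (f k)⁻¹ := by
  obtain ⟨F, hF, hF'⟩ := hf
  exact ⟨fun k => -F k, hF.neg, fun k => by rw [Complex.exp_neg, hF']⟩

theorem div (hf : HasLog f) (hg : HasLog g) : HasLog fun k => f k / g k := by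
  simpa only [div_eq_mul_inv] using hf.mul hg.inv

theorem comp (hf : HasLog f) {u : K' → K} (hu : Continuous u) : HasLog fun k => f (u k) := by
  obtain ⟨F, hF, hF'⟩ := hf
  exact ⟨fun k => F (u k), hF.comp hu, fun k => hF' _⟩

theorem congr (hf : HasLog f) (h : ∀ k, f k = g k) : HasLog g := by
  rwa [show g = f from funext fun k => (h k).symm]

theorem of_mem_slitPlane (hf : Continuous f) (h : ∀ k, f k ∈ slitPlane) : HasLog f :=
  ⟨fun k => Complex.log (f k), hf.clog h, fun k => Complex.exp_log (slitPlane_ne_zero (h k))⟩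

/-- Having a continuous logarithm is invariant under homotopy. -/
theorem of_preconnected {B : Type*} [TopologicalSpace B] [PreconnectedSpace B] [CompactSpace K]
    {f : B × K → ℂ} (hf : Continuous f) (h0 : ∀ z, f z ≠ 0) {a b : B}
    (ha : HasLog fun k => f (a, k)) : HasLog fun k => f (b, k) := by
  -- By compactness of `K`, nearby slices have a ratio uniformly close to 1, where the principal
  -- logarithm is continuous. So the parameters whose slice has a logarithm form a clopen set.
  have key : ∀ b₀ : B, ∀ᶠ b in 𝓝 b₀, ∀ k, f (b, k) / f (b₀, k) ∈ slitPlane := by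
    intro b₀
    have hc : Continuous fun z : B × K => f z / f (b₀, z.2) :=
      hf.div (hf.comp (continuous_const.prodMk continuous_snd)) fun z => h0 _
    have h := isCompact_univ.eventually_forall_of_forall_eventually (x₀ := b₀)
      (P := fun b k => f (b, k) / f (b₀, k) ∈ slitPlane) (K := (univ : Set K)) (fun k _ => by
        refine hc.continuousAt.eventually_mem (isOpen_slitPlane.mem_nhds ?_)
        simp [div_self (h0 (b₀, k)), one_mem_slitPlane])
    filter_upwards [h] with b hb k using hb k (mem_univ k)
  have hcont : ∀ b : B, Continuous fun k => f (b, k) := fun b =>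
    hf.comp (continuous_const.prodMk continuous_id)
  have hratio : ∀ b₀ : B, ∀ᶠ b in 𝓝 b₀, HasLog fun k => f (b, k) / f (b₀, k) := fun b₀ =>
    (key b₀).mono fun b hb =>
      of_mem_slitPlane ((hcont b).div (hcont b₀) fun k => h0 _) hb
  have hclopen : IsClopen {b | HasLog fun k => f (b, k)} := by
    constructor
    · rw [← isOpen_compl_iff, isOpen_iff_mem_nhds]
      intro b₀ hb₀
      filter_upwards [hratio b₀] with b hb hb'
      refine hb₀ ((hb'.div hb).congr fun k => ?_)
      field_simp [h0 (b, k), h0 (b₀, k)]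
    · rw [isOpen_iff_mem_nhds]
      intro b₀ hb₀
      filter_upwards [hratio b₀] with b hb
      refine (hb.mul hb₀).congr fun k => ?_
      field_simp [h0 (b₀, k)]
  have hb : b ∈ {b | HasLog fun k => f (b, k)} := by
    rw [hclopen.eq_univ ⟨a, ha⟩]
    exact mem_univ b
  exact hb

end HasLog

section AddCircle

variable {T : ℝ} [hT : Fact (0 < T)] {K : Type*} [TopologicalSpace K]

/-- Pulled back to ℝ, a logarithm minus the linear phase, divided by 2πi, is continuous and integer
valued, hence constant. But it would drop by 1 over a period. -/
theorem not_hasLog_toCircle : ¬ HasLog fun y : AddCircle T => (AddCircle.toCircle y : ℂ) := by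
  rintro ⟨g, hg, hg'⟩
  have hT0 : T ≠ 0 := hT.out.ne'
  have hTC : (T : ℂ) ≠ 0 := by exact_mod_cast hT0
  let d : ℝ → ℂ := fun t => (g (t : AddCircle T) - 2 * Real.pi / T * t * I) / (2 * Real.pi * I)
  have hd : Continuous d := by
    have : Continuous fun t : ℝ => g (t : AddCircle T) :=
      hg.comp (AddCircle.continuous_mk' T)
    fun_prop
  have hpi : (2 * Real.pi * I : ℂ) ≠ 0 := two_pi_I_ne_zero
  have hint : ∀ t, ∃ m : ℤ, d t = m := by
    intro t
    have h1 := hg' t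
    beta_reduce at h1
    rw [AddCircle.toCircle_apply_mk, Circle.coe_exp] at h1
    obtain ⟨m, hm⟩ := Complex.exp_eq_exp_iff_exists_int.1 h1
    refine ⟨m, ?_⟩
    simp only [d]
    rw [hm]
    push_cast
    field_simp
    ring
  choose m hm using hint
  have hmc : Continuous m := by
    have h2 : Continuous fun t => ((m t : ℤ) : ℂ) := by
      simpa only [← hm] using hd
    have h3 : Continuous fun t => ((m t : ℤ) : ℝ) := by
      have := Complex.continuous_re.comp h2
      simpa [Function.comp_def] using this
    exact Int.isClosedEmbedding_coe_real.isEmbedding.continuous_iff.2 h3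
  have hconst : m 0 = m T := PreconnectedSpace.constant inferInstance hmc
  have h4 : d 0 = d T := by rw [hm, hm, hconst]
  simp only [d] at h4
  rw [AddCircle.coe_period, AddCircle.coe_zero] at h4
  have h5 := (div_left_inj' hpi).1 h4
  have h6 : (2 * Real.pi / T * T * I : ℂ) = 0 := by
    push_cast at h5
    linear_combination h5
  apply hpi
  rw [← h6]
  field_simp

/-- Rotating the omitted point to −1 brings the image into the slit plane. -/
theorem hasLog_toCircle_of_ne {f : K → AddCircle T} (hf : Continuous f) {a : AddCircle T}
    (h : ∀ k, f k ≠ a) : HasLog fun k => (AddCircle.toCircle (f k) : ℂ) := by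
  have h1 : HasLog fun k => -(AddCircle.toCircle (f k - a) : ℂ) := by
    refine HasLog.of_mem_slitPlane ?_ fun k => ?_
    · exact (continuous_subtype_val.comp
        (AddCircle.continuous_toCircle.comp (hf.sub continuous_const))).neg
    · have hne : AddCircle.toCircle (f k - a) ≠ 1 := by
        intro h1
        rw [← AddCircle.toCircle_zero (T := T)] at h1
        exact h k (sub_eq_zero.1 (AddCircle.injective_toCircle hT.out.ne' h1))
      set w := AddCircle.toCircle (f k - a)
      by_contra hw
      rw [Complex.mem_slitPlane_iff] at hw
      push Not at hw
      obtain ⟨hre, him⟩ := hw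
      simp only [neg_re, neg_im, neg_eq_zero] at hre him
      apply hne
      have hn := Circle.normSq_coe w
      rw [Complex.normSq_apply, him] at hn
      have hre1 : (w : ℂ).re = 1 := by nlinarith
      ext
      exact Complex.ext (by simpa using hre1) (by simpa using him)
  refine ((h1.mul (HasLog.const (a := -(AddCircle.toCircle a : ℂ)) ?_))).congr fun k => ?_
  · exact neg_ne_zero.2 (Circle.coe_ne_zero _)
  · rw [neg_mul_neg, ← Circle.coe_mul, ← AddCircle.toCircle_add, sub_add_cancel]

/-- The logarithm of a unimodular function is purely imaginary; its rescaled imaginary part is the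
lift. -/
theorem HasLog.exists_lift {f : K → AddCircle T}
    (h : HasLog fun k => (AddCircle.toCircle (f k) : ℂ)) :
    ∃ g : K → ℝ, Continuous g ∧ ∀ k, (g k : AddCircle T) = f k := by
  obtain ⟨G, hG, hG'⟩ := h
  have hT0 : T ≠ 0 := hT.out.ne'
  refine ⟨fun k => T / (2 * Real.pi) * (G k).im, by fun_prop, fun k => ?_⟩
  apply AddCircle.injective_toCircle hT0
  have hG1 := hG' k
  beta_reduce at hG1 ⊢
  apply Circle.coe_injective
  rw [AddCircle.toCircle_apply_mk, Circle.coe_exp, ← hG1]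
  have hre : (G k).re = 0 := by
    have := congrArg norm hG1
    rw [Complex.norm_exp, Circle.norm_coe, Real.exp_eq_one_iff] at this
    exact this
  have him : 2 * Real.pi / T * (T / (2 * Real.pi) * (G k).im) = (G k).im := by
    field_simp
  rw [him]
  congr 1
  apply Complex.ext <;> simp [hre]

end AddCircle

section Nullhomotopic

variable {S T : ℝ} [hS : Fact (0 < S)] [hT : Fact (0 < T)] {K : Type*} [TopologicalSpace K]

/-- Both coordinates lift, so the map factors through the contractible plane. -/
theorem nullhomotopic_of_hasLog {γ : C(K, AddCircle S × AddCircle T)}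
    (h1 : HasLog fun k => (AddCircle.toCircle (γ k).1 : ℂ))
    (h2 : HasLog fun k => (AddCircle.toCircle (γ k).2 : ℂ)) : γ.Nullhomotopic := by
  obtain ⟨f, hf, hf'⟩ := h1.exists_lift
  obtain ⟨g, hg, hg'⟩ := h2.exists_lift
  let φ : C(K, ℝ × ℝ) := ⟨fun k => (f k, g k), hf.prodMk hg⟩
  let π : C(ℝ × ℝ, AddCircle S × AddCircle T) :=
    ⟨fun z => ((z.1 : AddCircle S), (z.2 : AddCircle T)),
      ((AddCircle.continuous_mk' S).comp continuous_fst).prodMk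
        ((AddCircle.continuous_mk' T).comp continuous_snd)⟩
  have : γ = π.comp φ := by
    ext k
    · exact (hf' k).symm
    · exact (hg' k).symm
  rw [this]
  have hid : (ContinuousMap.id (ℝ × ℝ)).Nullhomotopic := id_nullhomotopic (ℝ × ℝ)
  simpa using (hid.comp_left φ).comp_right π

theorem hasLog_of_nullhomotopic [CompactSpace K] {X : Type*} [TopologicalSpace X] {γ : C(K, X)}
    (h : γ.Nullhomotopic) {f : X → ℂ} (hf : Continuous f) (h0 : ∀ x, f x ≠ 0) :
    HasLog fun k => f (γ k) := by
  obtain ⟨y, ⟨H⟩⟩ := h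
  have h1 : HasLog fun k => f (H (1, k)) := by
    simpa using HasLog.const (K := K) (h0 y)
  have := HasLog.of_preconnected (B := unitInterval) (K := K) (f := fun z => f (H z)) (a := 1)
    (b := 0) (hf.comp H.continuous) (fun z => h0 _) h1
  simpa using this

end Nullhomotopic

end

/-! ### Compact connected one-manifolds are circles. -/

section

open Topology Filter Set

section OneManifold

variable {X : Type*} [TopologicalSpace X]

/-- One-dimensional invariance of domain. -/
theorem image_Icc_mem_nhds_of_injOn {ψ f : ℝ → X} (hψ : IsOpenEmbedding ψ) (hf : Continuous f)
    {a b t : ℝ} (ht : t ∈ Ioo a b) (hinj : InjOn f (Icc a b))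
    (hmaps : ∀ s ∈ Icc a b, f s ∈ range ψ) : f '' Icc a b ∈ 𝓝 (f t) := by
  have hab : a ≤ b := (ht.1.trans ht.2).le
  have ha : a ∈ Icc a b := left_mem_Icc.2 hab
  have hb : b ∈ Icc a b := right_mem_Icc.2 hab
  have htI : t ∈ Icc a b := Ioo_subset_Icc_self ht
  -- This is `f` read in the chart. Being continuous and injective on an interval it is strictly
  -- monotone, and the intermediate value theorem shows that its image surrounds `k t`.
  set k : ℝ → ℝ := fun s => Function.invFun ψ (f s)
  have hk : ∀ s ∈ Icc a b, ψ (k s) = f s := fun s hs => Function.invFun_eq (hmaps s hs)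
  have hkc : ContinuousOn k (Icc a b) := by
    rw [hψ.isInducing.continuousOn_iff]
    exact hf.continuousOn.congr hk
  have hki : InjOn k (Icc a b) := fun x hx y hy hxy =>
    hinj hx hy (by rw [← hk x hx, ← hk y hy, hxy])
  have main : ∀ c d, k t ∈ Ioo c d → Icc c d ⊆ k '' Icc a b → f '' Icc a b ∈ 𝓝 (f t) := by
    intro c d hcd hsub
    have h1 : ψ '' Ioo c d ∈ 𝓝 (f t) := by
      rw [← hk t htI]
      exact (hψ.isOpenMap _ isOpen_Ioo).mem_nhds (mem_image_of_mem ψ hcd)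
    refine mem_of_superset h1 ?_
    rintro _ ⟨r, hr, rfl⟩
    obtain ⟨s, hs, rfl⟩ := hsub (Ioo_subset_Icc_self hr)
    exact ⟨s, hs, (hk s hs).symm⟩
  rcases hkc.strictMonoOn_of_injOn_Icc' hab hki with hm | hm
  · exact main (k a) (k b) ⟨hm ha htI ht.1, hm htI hb ht.2⟩ (intermediate_value_Icc hab hkc)
  · exact main (k b) (k a) ⟨hm htI hb ht.2, hm ha htI ht.1⟩ (intermediate_value_Icc' hab hkc)

/-- Every point is the centre of an open arc. -/
def LocallyArc (X : Type*) [TopologicalSpace X] : Prop :=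
  ∀ z : X, ∃ ψ : ℝ → X, IsOpenEmbedding ψ ∧ ψ 0 = z

theorem LocallyArc.image_mem_nhds (hX : LocallyArc X) {f : ℝ → X} (hf : Continuous f) {t : ℝ}
    {U : Set ℝ} (hU : U ∈ 𝓝 t) (hinj : InjOn f U) : f '' U ∈ 𝓝 (f t) := by
  obtain ⟨ψ, hψ, hψ0⟩ := hX (f t)
  have h1 : f ⁻¹' range ψ ∈ 𝓝 t :=
    hf.continuousAt.preimage_mem_nhds (hψ.isOpen_range.mem_nhds ⟨0, hψ0⟩)
  obtain ⟨ε, hε, hsub⟩ := (Metric.nhds_basis_closedBall.mem_iff).1 (inter_mem hU h1)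
  rw [Real.closedBall_eq_Icc] at hsub
  refine mem_of_superset (image_Icc_mem_nhds_of_injOn hψ hf (a := t - ε) (b := t + ε)
    ⟨by linarith, by linarith⟩ (hinj.mono fun s hs => (hsub hs).1) fun s hs => (hsub hs).2) ?_
  exact image_mono fun s hs => (hsub hs).1

theorem LocallyArc.isOpenEmbedding (hX : LocallyArc X) {f : ℝ → X} (hf : Continuous f)
    (hinj : Function.Injective f) : IsOpenEmbedding f :=
  .of_continuous_injective_isOpenMap hf hinj <| isOpenMap_iff_nhds_le.2 fun t U hU => by
    have h1 : f ⁻¹' U ∈ 𝓝 t := hU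
    exact mem_of_superset (hX.image_mem_nhds hf h1 hinj.injOn) (image_preimage_subset f U)

/-- In a compact one-manifold, an open arc converges at its end. -/
theorem LocallyArc.exists_tendsto_atTop [CompactSpace X] [T2Space X] (hX : LocallyArc X) {φ : ℝ → X}
    (hφ : IsOpenEmbedding φ) : ∃ z, z ∉ range φ ∧ Tendsto φ atTop (𝓝 z) := by
  obtain ⟨z, hz⟩ := exists_clusterPt_of_compactSpace (map φ atTop)
  have hz : MapClusterPt z atTop φ := hz
  rw [mapClusterPt_iff_frequently] at hz
  refine ⟨z, ?_, ?_⟩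
  · rintro ⟨s, rfl⟩
    have h1 : φ '' Ioo (s - 1) (s + 1) ∈ 𝓝 (φ s) :=
      (hφ.isOpenMap _ isOpen_Ioo).mem_nhds ⟨s, ⟨by linarith, by linarith⟩, rfl⟩
    obtain ⟨t, ⟨r, hr, hrt⟩, ht⟩ := ((hz _ h1).and_eventually (eventually_gt_atTop (s + 1))).exists
    have := hφ.injective hrt
    subst this
    exact absurd hr.2 (not_lt.2 ht.le)
  · obtain ⟨ψ, hψ, rfl⟩ := hX z
    intro U hU
    obtain ⟨ε, hε, hsub⟩ := (Metric.nhds_basis_ball.mem_iff).1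
      (hψ.continuous.continuousAt.preimage_mem_nhds hU)
    rw [Real.ball_eq_Ioo, zero_sub, zero_add] at hsub
    -- An injective path passes through each point at most once. Its tail thus avoids both ends of
    -- the small arc around the cluster point; being connected and returning to that arc, it stays
    -- inside.
    have hne : ∀ p : X, ∀ᶠ t in atTop, φ t ≠ p := by
      intro p
      by_cases hp : p ∈ range φ
      · obtain ⟨s, rfl⟩ := hp
        filter_upwards [eventually_gt_atTop s] with t ht h
        exact ht.ne' (hφ.injective h)
      · exact Eventually.of_forall fun t h => hp ⟨t, h⟩
    obtain ⟨T, hT⟩ := eventually_atTop.1 ((hne (ψ ε)).and (hne (ψ (-ε))))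
    have hu : IsOpen (ψ '' Ioo (-ε) ε) := hψ.isOpenMap _ isOpen_Ioo
    have hv : IsOpen (ψ '' Icc (-ε) ε)ᶜ :=
      (isCompact_Icc.image hψ.continuous).isClosed.isOpen_compl
    have hS : IsPreconnected (φ '' Ici T) := isPreconnected_Ici.image _ hφ.continuous.continuousOn
    have key : φ '' Ici T ⊆ ψ '' Ioo (-ε) ε := by
      refine IsPreconnected.subset_left_of_subset_union hu hv ?_ ?_ ?_ hS
      · exact disjoint_compl_right.mono_left (image_mono Ioo_subset_Icc_self)
      · rintro _ ⟨t, ht, rfl⟩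
        by_cases hmem : φ t ∈ ψ '' Icc (-ε) ε
        · obtain ⟨r, hr, hrt⟩ := hmem
          left
          refine ⟨r, ⟨lt_of_le_of_ne hr.1 ?_, lt_of_le_of_ne hr.2 ?_⟩, hrt⟩
          · rintro rfl
            exact (hT t ht).2 hrt.symm
          · rintro rfl
            exact (hT t ht).1 hrt.symm
        · exact Or.inr hmem
      · obtain ⟨t, h1, h2⟩ := ((hz _ (hu.mem_nhds ⟨0, ⟨by linarith, hε⟩, rfl⟩)).and_eventually
          (eventually_ge_atTop T)).exists
        exact ⟨φ t, ⟨t, h2, rfl⟩, h1⟩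
    change φ ⁻¹' U ∈ atTop
    filter_upwards [eventually_ge_atTop T] with t ht
    obtain ⟨r, hr, hrt⟩ := key ⟨t, ht, rfl⟩
    rw [mem_preimage, ← hrt]
    exact hsub hr

theorem LocallyArc.exists_tendsto_atBot [CompactSpace X] [T2Space X] (hX : LocallyArc X) {φ : ℝ → X}
    (hφ : IsOpenEmbedding φ) : ∃ z, z ∉ range φ ∧ Tendsto φ atBot (𝓝 z) := by
  obtain ⟨z, hz, hz'⟩ := hX.exists_tendsto_atTop (hφ.comp (Homeomorph.neg ℝ).isOpenEmbedding)
  refine ⟨z, fun ⟨t, ht⟩ => hz ⟨-t, by simpa using ht⟩, ?_⟩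
  simpa [Function.comp_def] using hz'.comp tendsto_neg_atBot_atTop

/-- Reparametrizing by the tangent and adding the common limit closes the arc to an injective loop.
Its image is compact, and open by invariance of domain, so it is the whole connected space. -/
theorem LocallyArc.exists_circle_of_tendsto [T2Space X] [ConnectedSpace X] (hX : LocallyArc X)
    {φ : ℝ → X}
    (hφ : IsOpenEmbedding φ) {z : X} (hz : z ∉ range φ) (htop : Tendsto φ atTop (𝓝 z))
    (hbot : Tendsto φ atBot (𝓝 z)) :
    ∃ γ : C(Circle, X), Function.Injective γ ∧ Function.Surjective γ := by
  classical
  have hpi := Real.pi_pos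
  have : Fact (0 < Real.pi) := ⟨hpi⟩
  have hpp : -(Real.pi / 2) + Real.pi = Real.pi / 2 := by ring
  set J := Ioo (-(Real.pi / 2)) (Real.pi / 2) with hJ
  set f : ℝ → X := fun t => if t ∈ J then φ (Real.tan t) else z with hfdef
  have hfin : ∀ t ∈ J, f t = φ (Real.tan t) := fun t ht => if_pos ht
  have hfout : ∀ t, t ∉ J → f t = z := fun t ht => if_neg ht
  have hfcont : ContinuousOn f (Icc (-(Real.pi / 2)) (-(Real.pi / 2) + Real.pi)) := by
    rw [hpp]
    have hcin : ContinuousOn f J :=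
      (hφ.continuous.comp_continuousOn Real.continuousOn_tan_Ioo).congr hfin
    intro t ht
    rcases eq_or_lt_of_le ht.1 with h1 | h1
    · subst h1
      have h2 : f (-(Real.pi / 2)) = z := hfout _ fun h => lt_irrefl _ h.1
      have h3 : Tendsto f (𝓝[>] (-(Real.pi / 2))) (𝓝 z) := by
        refine (hbot.comp Real.tendsto_tan_neg_pi_div_two).congr' ?_
        filter_upwards [Ioo_mem_nhdsGT (show -(Real.pi / 2) < Real.pi / 2 by linarith)] with t ht
        exact (hfin t ht).symm
      have h4 : ContinuousWithinAt f (Ici (-(Real.pi / 2))) (-(Real.pi / 2)) := by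
        rw [← continuousWithinAt_Ioi_iff_Ici]
        rw [ContinuousWithinAt, h2]
        exact h3
      exact h4.mono Icc_subset_Ici_self
    rcases eq_or_lt_of_le ht.2 with h5 | h5
    · subst h5
      have h2 : f (Real.pi / 2) = z := hfout _ fun h => lt_irrefl _ h.2
      have h3 : Tendsto f (𝓝[<] (Real.pi / 2)) (𝓝 z) := by
        refine (htop.comp Real.tendsto_tan_pi_div_two).congr' ?_
        filter_upwards [Ioo_mem_nhdsLT (show -(Real.pi / 2) < Real.pi / 2 by linarith)] with t ht
        exact (hfin t ht).symm
      have h4 : ContinuousWithinAt f (Iic (Real.pi / 2)) (Real.pi / 2) := by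
        rw [← continuousWithinAt_Iio_iff_Iic]
        rw [ContinuousWithinAt, h2]
        exact h3
      exact h4.mono Icc_subset_Iic_self
    · exact (hcin.continuousAt (isOpen_Ioo.mem_nhds ⟨h1, h5⟩)).continuousWithinAt
  have hfinj : InjOn f (Ico (-(Real.pi / 2)) (-(Real.pi / 2) + Real.pi)) := by
    rw [hpp]
    intro s hs t ht hst
    by_cases h1 : s ∈ J <;> by_cases h2 : t ∈ J
    · rw [hfin s h1, hfin t h2] at hst
      exact Real.injOn_tan h1 h2 (hφ.injective hst)
    · rw [hfin s h1, hfout t h2] at hst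
      exact absurd ⟨_, hst⟩ hz
    · rw [hfout s h1, hfin t h2] at hst
      exact absurd ⟨_, hst.symm⟩ hz
    · have e : ∀ r ∈ Ico (-(Real.pi / 2)) (Real.pi / 2), r ∉ J → r = -(Real.pi / 2) :=
        fun r hr hr' => le_antisymm (not_lt.1 fun h => hr' ⟨h, hr.2⟩) hr.1
      rw [e s hs h1, e t ht h2]
  set F : AddCircle Real.pi → X := AddCircle.liftIco Real.pi (-(Real.pi / 2)) f
  have hFc : Continuous F := AddCircle.liftIco_continuous (by
    rw [hpp, hfout _ fun h => lt_irrefl _ h.1, hfout _ fun h => lt_irrefl _ h.2]) hfcont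
  have hFinj : Function.Injective F := by
    intro x y hxy
    obtain ⟨s, hs, rfl⟩ : x ∈ (fun t : ℝ => (t : AddCircle Real.pi)) '' Ico _ _ := by
      rw [AddCircle.coe_image_Ico_eq Real.pi (-(Real.pi / 2))]; trivial
    obtain ⟨t, ht, rfl⟩ : y ∈ (fun t : ℝ => (t : AddCircle Real.pi)) '' Ico _ _ := by
      rw [AddCircle.coe_image_Ico_eq Real.pi (-(Real.pi / 2))]; trivial
    simp only [F] at hxy
    rw [AddCircle.liftIco_coe_apply hs, AddCircle.liftIco_coe_apply ht] at hxy
    rw [hfinj hs ht hxy]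
  have hopen : IsOpen (range F) := by
    rw [isOpen_iff_mem_nhds]
    rintro _ ⟨x, rfl⟩
    obtain ⟨t, rfl⟩ := QuotientAddGroup.mk_surjective x
    have h1 : InjOn (fun s : ℝ => F (s : AddCircle Real.pi)) (Ico (t - Real.pi / 2)
        (t - Real.pi / 2 + Real.pi)) := fun r hr s hs hrs =>
      (AddCircle.coe_eq_coe_iff_of_mem_Ico hr hs).1 (hFinj hrs)
    refine mem_of_superset (hX.image_mem_nhds (hFc.comp (AddCircle.continuous_mk' _))
      (Ico_mem_nhds (by linarith) (by linarith)) h1) ?_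
    rintro _ ⟨s, -, rfl⟩
    exact ⟨_, rfl⟩
  have hclosed : IsClosed (range F) := (isCompact_range hFc).isClosed
  have huniv : range F = univ := IsClopen.eq_univ ⟨hclosed, hopen⟩ ⟨F 0, 0, rfl⟩
  let e := AddCircle.homeomorphCircle hpi.ne'
  refine ⟨⟨fun w => F (e.symm w), hFc.comp e.symm.continuous⟩,
    hFinj.comp e.symm.injective, ?_⟩
  exact (range_eq_univ.1 huniv).comp e.symm.surjective

/-- The folding `t ↦ T - |t|` tends to −∞ at both ends of ℝ, so the half-arc together with its limit
is compact. -/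
theorem isClosed_insert_image_Iic [T2Space X] {φ : ℝ → X} (hφ : Continuous φ) {z : X}
    (hz : Tendsto φ atBot (𝓝 z)) (T : ℝ) : IsClosed (insert z (φ '' Iic T)) := by
  have h1 : Tendsto (fun t : ℝ => T - |t|) (cocompact ℝ) atBot :=
    tendsto_atBot_add_const_left _ T (tendsto_neg_atTop_atBot.comp (tendsto_norm_cocompact_atTop))
  have h2 := (hz.comp h1).isCompact_insert_range_of_cocompact
    (hφ.comp (continuous_const.sub continuous_abs))
  convert h2.isClosed using 2
  ext x
  constructor
  · rintro ⟨t, ht, rfl⟩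
    exact ⟨T - t, by simp [abs_of_nonneg (sub_nonneg.2 (mem_Iic.1 ht))]⟩
  · rintro ⟨t, rfl⟩
    exact ⟨T - |t|, sub_le_self _ (abs_nonneg t), rfl⟩

theorem isClosed_insert_image_Ici [T2Space X] {φ : ℝ → X} (hφ : Continuous φ) {z : X}
    (hz : Tendsto φ atTop (𝓝 z)) (T : ℝ) : IsClosed (insert z (φ '' Ici T)) := by
  have h := isClosed_insert_image_Iic (hφ.comp continuous_neg)
    (hz.comp tendsto_neg_atBot_atTop) (-T)
  rwa [image_comp, image_neg_eq_neg, Set.neg_Iic, neg_neg] at h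

/-- A connected set that meets an open set but not its boundary is contained in it. -/
theorem IsPreconnected.subset_of_isClosed_insert {V U C : Set X} (hV : IsPreconnected V)
    (hU : IsOpen U) (hC : IsClosed C) (hVC : V ∩ C ⊆ U) (hUC : U ⊆ C) (hne : (V ∩ U).Nonempty) :
    V ⊆ U := by
  refine hV.subset_left_of_subset_union hU hC.isOpen_compl
    (disjoint_compl_right.mono_left hUC) (fun x hx => ?_) hne
  by_cases h : x ∈ C
  · exact Or.inl (hVC ⟨hx, h⟩)
  · exact Or.inr h

/-- Prolonging an open arc `φ` beyond its end by another open arc `ψ`. -/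
theorem LocallyArc.exists_extension [T2Space X] (hX : LocallyArc X) {φ ψ : ℝ → X}
    (hφ : IsOpenEmbedding φ)
    (hψ : IsOpenEmbedding ψ) {z : X} (hbot : Tendsto φ atBot (𝓝 z)) {T δ : ℝ} (hδ : δ < 0)
    (hT : φ T = ψ δ) (h0 : ψ 0 ∉ range φ) (hz0 : z ∉ ψ '' Ioi δ)
    (htop : φ '' Ioi T ⊆ ψ '' Ioi δ) :
    ∃ χ : ℝ → X, IsOpenEmbedding χ ∧ Tendsto χ atBot (𝓝 z) ∧
      (∀ t, T < t → χ t = ψ (t - T + δ)) ∧ range χ = range φ ∪ ψ '' Ici δ := by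
  classical
  -- The connected arc `ψ '' Ioi δ` avoids `z` and the junction `φ T`. If it met the part of `φ`
  -- before `T`, it would be contained in it, although `ψ 0` is not on `φ`.
  have hdisj : ∀ t ≤ T, ∀ s > δ, φ t ≠ ψ s := by
    intro t ht s hs hts
    have htT : t < T := lt_of_le_of_ne ht fun h => by
      subst h
      exact hs.ne (hψ.injective (hT.symm.trans hts))
    have h := IsPreconnected.subset_of_isClosed_insert (V := ψ '' Ioi δ) (U := φ '' Iio T)
      (C := insert z (φ '' Iic T)) (isPreconnected_Ioi.image _ hψ.continuous.continuousOn)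
      (hφ.isOpenMap _ isOpen_Iio) (isClosed_insert_image_Iic hφ.continuous hbot T) ?_
      ((image_mono Iio_subset_Iic_self).trans (subset_insert _ _)) ⟨φ t, ⟨s, hs, hts.symm⟩, t, htT, rfl⟩
    · obtain ⟨r, -, hr⟩ := h ⟨0, hδ, rfl⟩
      exact h0 ⟨r, hr⟩
    · rintro _ ⟨⟨r, hr, rfl⟩, h2⟩
      rcases h2 with h2 | ⟨u, hu, h2⟩
      · exact absurd ⟨r, hr, h2⟩ hz0
      · refine ⟨u, lt_of_le_of_ne (mem_Iic.1 hu) fun h => ?_, h2⟩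
        subst h
        exact (ne_of_lt hr) (hψ.injective (hT.symm.trans h2))
  set χ : ℝ → X := fun t => if t ≤ T then φ t else ψ (t - T + δ)
  have hle : ∀ t, t ≤ T → χ t = φ t := fun t ht => if_pos ht
  have hgt : ∀ t, T < t → χ t = ψ (t - T + δ) := fun t ht => if_neg (not_le.2 ht)
  have hc : Continuous χ := Continuous.if_le hφ.continuous
    (hψ.continuous.comp (by fun_prop)) continuous_id continuous_const (by
      rintro t rfl
      simp [hT])
  have hinj : Function.Injective χ := by
    intro s t hst
    rcases le_or_gt s T with h1 | h1 <;> rcases le_or_gt t T with h2 | h2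
    · rw [hle s h1, hle t h2] at hst
      exact hφ.injective hst
    · rw [hle s h1, hgt t h2] at hst
      exact absurd hst (hdisj s h1 _ (by linarith))
    · rw [hgt s h1, hle t h2] at hst
      exact absurd hst.symm (hdisj t h2 _ (by linarith))
    · rw [hgt s h1, hgt t h2] at hst
      have := hψ.injective hst
      linarith
  refine ⟨χ, hX.isOpenEmbedding hc hinj, hbot.congr' ?_, hgt, ?_⟩
  · filter_upwards [eventually_le_atBot T] with t ht using (hle t ht).symm
  · apply Subset.antisymm
    · rintro _ ⟨t, rfl⟩
      rcases le_or_gt t T with h | h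
      · rw [hle t h]
        exact Or.inl ⟨t, rfl⟩
      · rw [hgt t h]
        exact Or.inr ⟨_, by rw [mem_Ici]; linarith, rfl⟩
    · have hsub : ψ '' Ici δ ⊆ range χ := by
        rintro _ ⟨s, hs, rfl⟩
        rcases eq_or_lt_of_le (mem_Ici.1 hs) with h | h
        · exact ⟨T, by rw [hle T le_rfl, hT, h]⟩
        · exact ⟨s - δ + T, by rw [hgt _ (by linarith)]; congr 1; ring⟩
      rintro x (⟨t, rfl⟩ | hx)
      · rcases le_or_gt t T with h | h
        · exact ⟨t, hle t h⟩
        · exact hsub (image_mono Ioi_subset_Ici_self (htop ⟨t, h, rfl⟩))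
      · exact hsub hx

/-- Near its end, an open arc lies on one side of the end point. -/
theorem exists_chart_side {φ ψ : ℝ → X} (hφ : IsOpenEmbedding φ) (hψ : IsOpenEmbedding ψ)
    (h0 : ψ 0 ∉ range φ) (htop : Tendsto φ atTop (𝓝 (ψ 0))) :
    ∃ ψ' : ℝ → X, IsOpenEmbedding ψ' ∧ ψ' 0 = ψ 0 ∧ range ψ' = range ψ ∧
      ∃ T₀, φ '' Ici T₀ ⊆ ψ' '' Iio 0 := by
  obtain ⟨T, hT⟩ := eventually_atTop.1
    (htop.eventually (hψ.isOpen_range.mem_nhds (mem_range_self (f := ψ) 0)))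
  have hsub : φ '' Ici T ⊆ ψ '' Iio 0 ∪ ψ '' Ioi 0 := by
    rintro _ ⟨t, ht, rfl⟩
    obtain ⟨s, hs⟩ := hT t ht
    rcases lt_trichotomy s 0 with h | h | h
    · exact Or.inl ⟨s, h, hs⟩
    · subst h
      exact absurd ⟨t, hs.symm⟩ h0
    · exact Or.inr ⟨s, h, hs⟩
  have hdisj : Disjoint (ψ '' Iio 0) (ψ '' Ioi 0) :=
    (disjoint_image_iff hψ.injective).2 (Set.disjoint_left.2 fun x h1 h2 => lt_asymm (α := ℝ) h1 h2)
  rcases (isPreconnected_Ici.image φ hφ.continuous.continuousOn).subset_or_subset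
    (hψ.isOpenMap _ isOpen_Iio) (hψ.isOpenMap _ isOpen_Ioi) hdisj hsub with h | h
  · exact ⟨ψ, hψ, rfl, rfl, T, h⟩
  · refine ⟨fun t => ψ (-t), hψ.comp (Homeomorph.neg ℝ).isOpenEmbedding, by simp, ?_, T, ?_⟩
    · exact (Homeomorph.neg ℝ).surjective.range_comp ψ
    · rintro x hx
      obtain ⟨s, hs, rfl⟩ := h hx
      exact ⟨-s, by simpa using hs, by simp⟩

/-- After time `T` the arc cannot pass through `ψ δ` again, and it tends to `ψ 0`, so it stays
beyond `δ` in the chart. -/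
theorem image_Ioi_subset_of_side {φ ψ : ℝ → X} (hφ : IsOpenEmbedding φ) (hψ : IsOpenEmbedding ψ)
    (htop : Tendsto φ atTop (𝓝 (ψ 0))) {T δ : ℝ} (hδ : δ < 0) (hT : φ T = ψ δ)
    (hside : φ '' Ici T ⊆ ψ '' Iio 0) : φ '' Ioi T ⊆ ψ '' Ioi δ := by
  have hdisj : Disjoint (ψ '' Ioi δ) (ψ '' Iio δ) :=
    (disjoint_image_iff hψ.injective).2 (Set.disjoint_left.2 fun x h1 h2 => lt_asymm (α := ℝ) h1 h2)
  refine IsPreconnected.subset_left_of_subset_union (hψ.isOpenMap _ isOpen_Ioi)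
    (hψ.isOpenMap _ isOpen_Iio) hdisj ?_ ?_ (isPreconnected_Ioi.image φ hφ.continuous.continuousOn)
  · rintro _ ⟨t, ht, rfl⟩
    obtain ⟨s, -, hs⟩ := hside ⟨t, mem_Ici.2 (mem_Ioi.1 ht).le, rfl⟩
    rcases lt_trichotomy s δ with h | h | h
    · exact Or.inr ⟨s, h, hs⟩
    · subst h
      exact absurd (hφ.injective (hT.trans hs)) (ne_of_lt ht)
    · exact Or.inl ⟨s, h, hs⟩
  · obtain ⟨t, h1, h2⟩ := ((htop.eventually ((hψ.isOpenMap _ isOpen_Ioi).mem_nhds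
      (mem_image_of_mem ψ (mem_Ioi.2 hδ)))).and (eventually_gt_atTop T)).exists
    exact ⟨φ t, ⟨t, h2, rfl⟩, h1⟩

/-- A chart can be cut off at a point on its positive side. -/
theorem exists_chart_truncation (hX : LocallyArc X) {ψ : ℝ → X} (hψ : IsOpenEmbedding ψ) {s : ℝ}
    (hs : 0 < s) :
    ∃ ψ' : ℝ → X, IsOpenEmbedding ψ' ∧ ψ' 0 = ψ 0 ∧ ψ' '' Iio 0 = ψ '' Iio 0 ∧
      range ψ' = ψ '' Iio s ∧ Tendsto ψ' atTop (𝓝 (ψ s)) := by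
  -- An increasing bijection from ℝ onto the half-line below `s` that fixes 0.
  set ρ : ℝ → ℝ := fun t => s * (1 - Real.exp (-t)) with hρ
  have hmono : StrictMono ρ := fun a b hab => by
    have : Real.exp (-b) < Real.exp (-a) := Real.exp_lt_exp.2 (by linarith)
    simp only [hρ]
    nlinarith
  have hρ0 : ρ 0 = 0 := by simp [hρ]
  have hρc : Continuous ρ := by fun_prop
  have hlt : ∀ t, ρ t < s := fun t => by
    have := Real.exp_pos (-t)
    simp only [hρ]
    nlinarith
  have hsurj : ∀ r < s, ∃ t, ρ t = r := fun r hr => by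
    have h1 : 0 < 1 - r / s := by rw [sub_pos, div_lt_one hs]; exact hr
    refine ⟨-Real.log (1 - r / s), ?_⟩
    simp only [hρ, neg_neg, Real.exp_log h1]
    field_simp
    ring
  refine ⟨fun t => ψ (ρ t), hX.isOpenEmbedding (hψ.continuous.comp hρc)
    (hψ.injective.comp hmono.injective), by simp [hρ0], ?_, ?_, ?_⟩
  · ext x
    constructor
    · rintro ⟨t, ht, rfl⟩
      exact ⟨ρ t, by rw [mem_Iio, ← hρ0]; exact hmono ht, rfl⟩
    · rintro ⟨r, hr, rfl⟩
      obtain ⟨t, rfl⟩ := hsurj r (lt_trans hr hs)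
      refine ⟨t, ?_, rfl⟩
      rw [mem_Iio, ← hρ0] at hr
      exact hmono.lt_iff_lt.1 hr
  · ext x
    constructor
    · rintro ⟨t, rfl⟩
      exact ⟨ρ t, hlt t, rfl⟩
    · rintro ⟨r, hr, rfl⟩
      obtain ⟨t, rfl⟩ := hsurj r hr
      exact ⟨t, rfl⟩
  · refine (hψ.continuous.tendsto s).comp ?_
    have h1 : Tendsto (fun t : ℝ => Real.exp (-t)) atTop (𝓝 0) :=
      Real.tendsto_exp_neg_atTop_nhds_zero
    have h2 := (h1.const_sub 1).const_mul s
    simpa [hρ] using h2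

/-- Classification of compact connected one-manifolds. -/
theorem LocallyArc.exists_circle [CompactSpace X] [T2Space X] [ConnectedSpace X]
    (hX : LocallyArc X) :
    ∃ γ : C(Circle, X), Function.Injective γ ∧ Function.Surjective γ := by
  classical
  choose ψ hψ hψ0 using hX
  obtain ⟨F, -, hF⟩ := isCompact_univ.elim_nhds_subcover (fun z => range (ψ z)) fun z _ =>
    (hψ z).isOpen_range.mem_nhds ⟨0, hψ0 z⟩
  have hX : LocallyArc X := fun z => ⟨ψ z, hψ z, hψ0 z⟩
  -- Maximality is imposed only on the number of charts of a finite cover that the arc contains.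
  -- This number is bounded, so a maximal arc exists without Zorn's lemma.
  let count : (ℝ → X) → ℕ := fun φ => (F.filter fun w => range (ψ w) ⊆ range φ).card
  obtain ⟨φ, hφ, hmax⟩ : ∃ φ : ℝ → X, IsOpenEmbedding φ ∧
      ∀ χ : ℝ → X, IsOpenEmbedding χ → count χ ≤ count φ := by
    have hne : (count '' {φ | IsOpenEmbedding φ}).Nonempty :=
      ⟨_, ψ (Classical.arbitrary X), hψ _, rfl⟩
    have hbdd : BddAbove (count '' {φ | IsOpenEmbedding φ}) :=
      ⟨F.card, by rintro _ ⟨φ, -, rfl⟩; exact Finset.card_filter_le _ _⟩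
    obtain ⟨φ, hφ, h⟩ := Nat.sSup_mem hne hbdd
    exact ⟨φ, hφ, fun χ hχ => h ▸ le_csSup hbdd ⟨χ, hχ, rfl⟩⟩
  have hmax' : ∀ χ : ℝ → X, IsOpenEmbedding χ → range φ ⊆ range χ → ∀ w ∈ F,
      range (ψ w) ⊆ range χ → range (ψ w) ⊆ range φ := by
    intro χ hχ hsub w hw hwχ
    by_contra hcon
    refine absurd (hmax χ hχ) (not_le.2 (Finset.card_lt_card ?_))
    rw [Finset.ssubset_iff_of_subset]
    · exact ⟨w, by simp [hw, hwχ], by simp [hcon]⟩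
    · intro v hv
      rw [Finset.mem_filter] at hv ⊢
      exact ⟨hv.1, hv.2.trans hsub⟩
  obtain ⟨p, hp, hptop⟩ := hX.exists_tendsto_atTop hφ
  obtain ⟨q, hq, hqbot⟩ := hX.exists_tendsto_atBot hφ
  by_cases hpq : p = q
  · subst hpq
    exact hX.exists_circle_of_tendsto hφ hp hptop hqbot
  obtain ⟨w, hw, hpw⟩ : ∃ w ∈ F, p ∈ range (ψ w) := by simpa using hF (mem_univ p)
  have hwφ : ¬ range (ψ w) ⊆ range φ := fun h => hp (h hpw)
  obtain ⟨s₀, hs₀⟩ := hpw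
  obtain ⟨α, hα, hα0, hαr, T₀, hside⟩ := exists_chart_side hφ (ψ := fun t => ψ w (t + s₀))
    ((hψ w).comp (Homeomorph.addRight s₀).isOpenEmbedding) (by simpa [hs₀] using hp)
    (by simpa [hs₀] using hptop)
  simp only [zero_add, hs₀] at hα0
  have hαr : range α = range (ψ w) := by
    rw [hαr]
    exact (Homeomorph.addRight s₀).surjective.range_comp (ψ w)
  subst hα0
  have hUopen := hφ.isOpen_range
  -- a suitable extension
  have extend : ∀ β : ℝ → X, IsOpenEmbedding β → β 0 = α 0 → β '' Iio 0 = α '' Iio 0 →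
      q ∉ range β → ∃ χ : ℝ → X, IsOpenEmbedding χ ∧ Tendsto χ atBot (𝓝 q) ∧
        (∃ T δ, ∀ t, T < t → χ t = β (t - T + δ)) ∧ ∃ δ < 0, ∃ T, φ T = β δ ∧
          range χ = range φ ∪ β '' Ici δ := by
    intro β hβ hβ0 hβside hqβ
    obtain ⟨δ, hδ, hδT⟩ : φ T₀ ∈ β '' Iio 0 := hβside ▸ hside ⟨T₀, self_mem_Ici, rfl⟩
    obtain ⟨χ, h1, h2, h3, h4⟩ := hX.exists_extension hφ hβ hqbot hδ hδT.symm (by rwa [hβ0])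
      (fun h => hqβ (image_subset_range _ _ h))
      (image_Ioi_subset_of_side hφ hβ (by rwa [hβ0]) hδ hδT.symm (by rwa [hβside]))
    exact ⟨χ, h1, h2, ⟨T₀, δ, h3⟩, δ, hδ, T₀, hδT.symm, h4⟩
  have htopset : IsClosed (insert (α 0) (φ '' Ici 0)) :=
    isClosed_insert_image_Ici hφ.continuous hptop 0
  have hbotset : IsClosed (insert q (φ '' Iic 0)) :=
    isClosed_insert_image_Iic hφ.continuous hqbot 0
  have hclosed : IsClosed (insert (α 0) (insert q (range φ))) := by
    convert htopset.union hbotset using 1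
    rw [← image_univ, ← Iic_union_Ici (a := (0 : ℝ)), image_union]
    ext x
    simp only [mem_insert_iff, mem_union]
    tauto
  by_cases hqα : q ∈ range α
  · obtain ⟨s, rfl⟩ := hqα
    rcases lt_trichotomy s 0 with hs | rfl | hs
    · exfalso
      -- Here `q` lies on the side from which `φ` arrives at its end. Then `φ` is trapped between
      -- its two end points inside the chart, and the chart itself contradicts maximality.
      have hsub : range φ ⊆ α '' Ioo s 0 := by
        refine IsPreconnected.subset_of_isClosed_insert (isPreconnected_range hφ.continuous)
          (hα.isOpenMap _ isOpen_Ioo) ((isCompact_Icc (a := s) (b := 0)).image hα.continuous).isClosed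
          ?_ (image_mono Ioo_subset_Icc_self) ?_
        · rintro x ⟨hx, r, hr, rfl⟩
          refine ⟨r, ⟨lt_of_le_of_ne hr.1 ?_, lt_of_le_of_ne hr.2 ?_⟩, rfl⟩
          · rintro rfl
            exact hq hx
          · rintro rfl
            exact hp hx
        · obtain ⟨t, h1, h2⟩ := ((hptop.eventually ((hα.isOpenMap _ isOpen_Ioi).mem_nhds
            (mem_image_of_mem α (mem_Ioi.2 hs)))).and (eventually_ge_atTop T₀)).exists
          obtain ⟨r, hr, hrt⟩ := h1
          obtain ⟨r', hr', hrt'⟩ := hside ⟨t, h2, rfl⟩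
          have := hα.injective (hrt.trans hrt'.symm)
          subst this
          exact ⟨φ t, ⟨t, rfl⟩, r, ⟨hr, hr'⟩, hrt⟩
      exact hwφ (hmax' α hα (hsub.trans (image_subset_range _ _)) w hw hαr.ge)
    · exact absurd rfl hpq
    -- The chart at one end of `φ` contains the other end `q` on its far side. Prolonging `φ` only
    -- up to `q` gives an arc with equal ends.
    · obtain ⟨β, hβ, hβ0, hβside, hβr, hβtop⟩ := exists_chart_truncation hX hα hs
      have hqβ : α s ∉ range β := by
        rw [hβr]
        rintro ⟨r, hr, hrs⟩
        exact (ne_of_lt hr) (hα.injective hrs)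
      obtain ⟨χ, hχ, hχbot, ⟨T, δ, hT⟩, δ', -, -, -, hr⟩ := extend β hβ hβ0 hβside hqβ
      refine hX.exists_circle_of_tendsto hχ (z := α s) ?_ ?_ hχbot
      · rw [hr]
        rintro (h | h)
        · exact hq h
        · exact hqβ (image_subset_range _ _ h)
      · refine Tendsto.congr' (f₁ := fun t => β (t - T + δ)) ?_ (hβtop.comp ?_)
        · filter_upwards [eventually_gt_atTop T] with t ht using (hT t ht).symm
        · exact tendsto_atTop_add_const_right _ _ (tendsto_atTop_add_const_right _ _ tendsto_id)
  · exfalso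
    obtain ⟨χ, hχ, -, -, δ, hδ, T, hT, hr⟩ := extend α hα rfl rfl hqα
    refine hwφ (hmax' χ hχ (hr ▸ subset_union_left) w hw ?_)
    rw [← hαr, hr]
    -- The near half of the chart avoids both ends of `φ` but meets `φ`, so it lies on it. The
    -- extension thus contains the whole chart, against maximality.
    have hneg : α '' Iio 0 ⊆ range φ := by
      refine IsPreconnected.subset_of_isClosed_insert
        (isPreconnected_Iio.image _ hα.continuous.continuousOn) hUopen hclosed ?_
        ((subset_insert _ _).trans (subset_insert _ _))
        ⟨φ T₀, hside ⟨T₀, self_mem_Ici, rfl⟩, T₀, rfl⟩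
      rintro _ ⟨⟨r, hr, rfl⟩, h | h | h⟩
      · exact absurd (hα.injective h) (ne_of_lt hr)
      · exact absurd ⟨r, h⟩ hqα
      · exact h
    rintro _ ⟨r, rfl⟩
    rcases lt_or_ge r 0 with h | h
    · exact Or.inl (hneg ⟨r, h, rfl⟩)
    · exact Or.inr ⟨r, hδ.le.trans h, rfl⟩

end OneManifold

end

/-! ### The motions of human and puppy, phase by phase. -/

section

open Topology Filter Set

section CyclicSums

variable {n : ℕ}

theorem Fin.val_add_one_of_lt_card [NeZero n] {k : Fin n} (hk : k.val + 1 < n) :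
    (k + 1).val = k.val + 1 := by
  rw [Fin.val_add, Fin.val_one', Nat.add_mod_mod, Nat.mod_eq_of_lt hk]

theorem Fin.add_one_eq_zero_of_card_le [NeZero n] {k : Fin n} (hk : n ≤ k.val + 1) : k + 1 = 0 := by
  have h : k.val + 1 = n := by omega
  apply Fin.ext
  rw [Fin.val_add, Fin.val_one', Nat.add_mod_mod, h, Nat.mod_self, Fin.val_zero]

theorem Fin.cyclic_induction [NeZero n] {p : Fin n → Prop} (h0 : p 0)
    (hs : ∀ k : Fin n, k.val + 1 < n → p k → p (k + 1)) (i : Fin n) : p i := by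
  obtain ⟨m, hm⟩ := i
  induction m with
  | zero => exact h0
  | succ m ih =>
    have h1 := hs ⟨m, by omega⟩ hm (ih (by omega))
    rwa [show (⟨m, by omega⟩ : Fin n) + 1 = ⟨m + 1, hm⟩ from
      Fin.ext (Fin.val_add_one_of_lt_card (k := ⟨m, by omega⟩) hm)] at h1

theorem Fin.Iio_add_one [NeZero n] {k : Fin n} (hk : k.val + 1 < n) :
    Finset.Iio (k + 1) = insert k (Finset.Iio k) := by
  ext j
  rw [Finset.mem_Iio, Finset.mem_insert, Finset.mem_Iio, Fin.lt_def,
    Fin.val_add_one_of_lt_card hk, Fin.lt_def, Fin.ext_iff]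
  omega

theorem Fin.sum_Iio_add_one [NeZero n] {M : Type*} [AddCommMonoid M] (f : Fin n → M) {k : Fin n}
    (hk : k.val + 1 < n) :
    ∑ j ∈ Finset.Iio (k + 1), f j = ∑ j ∈ Finset.Iio k, f j + f k := by
  rw [Fin.Iio_add_one hk, Finset.sum_insert (by simp), add_comm]

theorem Fin.sum_Iio_zero [NeZero n] {M : Type*} [AddCommMonoid M] (f : Fin n → M) :
    ∑ j ∈ Finset.Iio (0 : Fin n), f j = 0 := by
  rw [show Finset.Iio (0 : Fin n) = ∅ by ext j; simp, Finset.sum_empty]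

theorem Fin.sum_Iio_add_last {M : Type*} [AddCommMonoid M] (f : Fin n → M) {k : Fin n}
    (hk : n ≤ k.val + 1) : ∑ j ∈ Finset.Iio k, f j + f k = ∑ j, f j := by
  rw [show (Finset.univ : Finset (Fin n)) = insert k (Finset.Iio k) from ?_,
    Finset.sum_insert (by simp), add_comm]
  ext j
  rw [Finset.mem_insert, Finset.mem_Iio, Fin.lt_def, Fin.ext_iff]
  simp only [Finset.mem_univ, true_iff]
  omega

variable {d : Fin n → ℝ}

theorem sum_Iio_add_le_sum_Iio (hd : ∀ i, 0 ≤ d i) {i j : Fin n} (hij : i < j) :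
    ∑ k ∈ Finset.Iio i, d k + d i ≤ ∑ k ∈ Finset.Iio j, d k := by
  rw [add_comm, ← Finset.sum_insert (by simp)]
  refine Finset.sum_le_sum_of_subset_of_nonneg (fun k hk => ?_) fun k _ _ => hd k
  rw [Finset.mem_insert, Finset.mem_Iio] at hk
  rw [Finset.mem_Iio]
  rcases hk with rfl | hk
  · exact hij
  · exact hk.trans hij

theorem sum_Iio_add_le_sum (hd : ∀ i, 0 ≤ d i) (i : Fin n) :
    ∑ k ∈ Finset.Iio i, d k + d i ≤ ∑ k, d k := by
  rw [add_comm, ← Finset.sum_insert (by simp)]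
  exact Finset.sum_le_sum_of_subset_of_nonneg (Finset.subset_univ _) fun k _ _ => hd k

theorem exists_sum_Iio_le [NeZero n] {t : ℝ} (h0 : 0 ≤ t) (ht : t < ∑ k, d k) :
    ∃ i, ∑ k ∈ Finset.Iio i, d k ≤ t ∧ t < ∑ k ∈ Finset.Iio i, d k + d i := by
  by_contra! hcon
  have h : ∀ i : Fin n, ∑ k ∈ Finset.Iio i, d k ≤ t := by
    refine Fin.cyclic_induction (by rwa [Fin.sum_Iio_zero]) fun k hk ih => ?_
    rw [Fin.sum_Iio_add_one _ hk]
    exact hcon k ih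
  have hn : 0 < n := Nat.pos_of_ne_zero (NeZero.ne n)
  have h1 := hcon ⟨n - 1, by omega⟩ (h _)
  rw [Fin.sum_Iio_add_last d (k := ⟨n - 1, by omega⟩) (by simp only; omega)] at h1
  linarith

theorem coe_sum_Iio_add_one [NeZero n] (i : Fin n) :
    ((∑ k ∈ Finset.Iio (i + 1), d k : ℝ) : AddCircle (∑ k, d k)) =
      ((∑ k ∈ Finset.Iio i, d k + d i : ℝ) : AddCircle (∑ k, d k)) := by
  by_cases h : i.val + 1 < n
  · rw [Fin.sum_Iio_add_one _ h]
  · push Not at h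
    rw [Fin.sum_Iio_add_last _ h, Fin.add_one_eq_zero_of_card_le h, Fin.sum_Iio_zero,
      AddCircle.coe_period, AddCircle.coe_zero]

/-- The shape of every sum of ramps at a time in phase `i`: earlier ramps are complete, later ones
have not begun. -/
theorem sum_eq_sum_Iio_add {M : Type*} [AddCommMonoid M] {g a : Fin n → M} {b : M} (i : Fin n)
    (h1 : ∀ k < i, g k = a k) (h2 : g i = b) (h3 : ∀ k, i < k → g k = 0) :
    ∑ k, g k = ∑ k ∈ Finset.Iio i, a k + b := by
  rw [← Finset.sum_subset (Finset.subset_univ (insert i (Finset.Iio i))),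
    Finset.sum_insert (by simp), h2, add_comm]
  · congr 1
    exact Finset.sum_congr rfl fun k hk => h1 k (Finset.mem_Iio.1 hk)
  · intro k _ hk
    rw [Finset.mem_insert, Finset.mem_Iio, not_or, not_lt] at hk
    exact h3 k (lt_of_le_of_ne hk.2 (Ne.symm hk.1))

end CyclicSums

/-- Including the right end point allows each phase to be treated as a closed interval, even the
last one. -/
theorem AddCircle.liftIco_zero_coe_apply_of_mem_Icc {B : Type*} {p : ℝ} [hp : Fact (0 < p)]
    {f : ℝ → B} (hf : f 0 = f p) {t : ℝ} (ht : t ∈ Icc 0 p) :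
    AddCircle.liftIco p 0 f (t : AddCircle p) = f t := by
  rcases eq_or_lt_of_le ht.2 with h | h
  · rw [h, AddCircle.coe_period, ← AddCircle.coe_zero,
      AddCircle.liftIco_zero_coe_apply ⟨le_rfl, hp.out⟩, hf]
  · exact AddCircle.liftIco_zero_coe_apply ⟨ht.1, h⟩

namespace SimplePolygon

theorem ramp_of_le {a d t : ℝ} (hd : 0 ≤ d) (h : a + d ≤ t) : ramp a d t = d := by
  rw [ramp, min_eq_left (by linarith), max_eq_right hd]

theorem ramp_of_mem {a d t : ℝ} (h1 : a ≤ t) (h2 : t ≤ a + d) : ramp a d t = t - a := by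
  rw [ramp, min_eq_right (by linarith), max_eq_right (by linarith)]

theorem ramp_of_ge {a d t : ℝ} (h : t ≤ a) : ramp a d t = 0 := by
  rw [ramp, max_eq_left]
  exact (min_le_right _ _).trans (by linarith)

theorem continuous_ramp (a d : ℝ) : Continuous (ramp a d) := by
  unfold ramp
  fun_prop

variable {n : ℕ} [NeZero n] (P : SimplePolygon n)

theorem edgeLength_nonneg (i : Fin n) : 0 ≤ P.edgeLength i := (P.edgeLength_pos i).le

theorem edgeVec_ne_zero (i : Fin n) : P.edgeVec i ≠ 0 := norm_pos_iff.1 (P.edgeLength_pos i)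

theorem edgeLength_ne_zero (i : Fin n) : (P.edgeLength i : ℂ) ≠ 0 := by
  exact_mod_cast (P.edgeLength_pos i).ne'

theorem edgeLength_mul_edgeDir (i : Fin n) :
    (P.edgeLength i : ℂ) * P.edgeDir i = P.edgeVec i := by
  rw [edgeDir]
  field_simp [P.edgeLength_ne_zero i]

theorem norm_edgeDir (i : Fin n) : ‖P.edgeDir i‖ = 1 := by
  rw [edgeDir, norm_div, Complex.norm_real, Real.norm_of_nonneg (P.edgeLength_nonneg i)]
  exact div_self (P.edgeLength_pos i).ne'

theorem vertices_add_edge (i : Fin n) :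
    P.vertices i + (P.edgeLength i : ℂ) * P.edgeDir i = P.vertices (i + 1) := by
  rw [edgeLength_mul_edgeDir, edgeVec]
  ring

theorem vertices_eq_sum (i : Fin n) :
    P.vertices i = P.vertices 0 + ∑ k ∈ Finset.Iio i, (P.edgeLength k : ℂ) * P.edgeDir k := by
  refine Fin.cyclic_induction (p := fun i => P.vertices i = P.vertices 0 +
    ∑ k ∈ Finset.Iio i, (P.edgeLength k : ℂ) * P.edgeDir k)
    (by rw [Fin.sum_Iio_zero, add_zero]) (fun k hk ih => ?_) i
  rw [Fin.sum_Iio_add_one _ hk, ← add_assoc, ← ih, vertices_add_edge]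

theorem edgeDir_mul_exp_turn (i : Fin n) :
    P.edgeDir i * Complex.exp (Complex.I * P.turn i) = P.edgeDir (i + 1) := by
  have h := Complex.norm_mul_exp_arg_mul_I (P.edgeVec (i + 1) / P.edgeVec i)
  rw [norm_div] at h
  have h1 := P.edgeVec_ne_zero i
  have h2 : (‖P.edgeVec i‖ : ℂ) ≠ 0 := P.edgeLength_ne_zero i
  have h3 : (‖P.edgeVec (i + 1)‖ : ℂ) ≠ 0 := P.edgeLength_ne_zero (i + 1)
  rw [edgeDir, edgeDir, edgeLength, edgeLength, turn, mul_comm Complex.I]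
  push_cast at h
  field_simp at h ⊢
  linear_combination h

theorem edgeDir_eq_mul_exp (i : Fin n) : P.edgeDir i =
    P.edgeDir 0 * Complex.exp (Complex.I * (∑ k ∈ Finset.Iio i, P.turn k : ℝ)) := by
  refine Fin.cyclic_induction (p := fun i => P.edgeDir i =
    P.edgeDir 0 * Complex.exp (Complex.I * (∑ k ∈ Finset.Iio i, P.turn k : ℝ)))
    ?_ (fun k hk ih => ?_) i
  · rw [Fin.sum_Iio_zero]
    simp
  · rw [Fin.sum_Iio_add_one _ hk, Complex.ofReal_add, mul_add, Complex.exp_add, ← mul_assoc, ← ih,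
      edgeDir_mul_exp_turn]

theorem sign_mul_abs_turn (i : Fin n) :
    ((SignType.sign (P.turn i) : SignType) : ℝ) * |P.turn i| = P.turn i :=
  sign_mul_abs _

/-- The duration of the `i`-th phase of the puppy: edge `i` and the turn at its end. -/
noncomputable def phaseLength (i : Fin n) : ℝ := P.edgeLength i + |P.turn i|

theorem phaseLength_nonneg (i : Fin n) : 0 ≤ P.phaseLength i :=
  add_nonneg (P.edgeLength_nonneg i) (abs_nonneg _)

theorem humanStart_nonneg (i : Fin n) : 0 ≤ P.humanStart i :=
  Finset.sum_nonneg fun k _ => P.edgeLength_nonneg k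

theorem puppyStart_nonneg (i : Fin n) : 0 ≤ P.puppyStart i :=
  Finset.sum_nonneg fun k _ => P.phaseLength_nonneg k

theorem humanStart_add_le {i j : Fin n} (h : i < j) :
    P.humanStart i + P.edgeLength i ≤ P.humanStart j :=
  sum_Iio_add_le_sum_Iio P.edgeLength_nonneg h

theorem puppyStart_add_le {i j : Fin n} (h : i < j) :
    P.puppyStart i + (P.edgeLength i + |P.turn i|) ≤ P.puppyStart j :=
  sum_Iio_add_le_sum_Iio P.phaseLength_nonneg h

theorem humanStart_add_le_perimeter (i : Fin n) :
    P.humanStart i + P.edgeLength i ≤ P.perimeter :=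
  sum_Iio_add_le_sum P.edgeLength_nonneg i

theorem puppyStart_add_le_puppyPeriod (i : Fin n) :
    P.puppyStart i + (P.edgeLength i + |P.turn i|) ≤ P.puppyPeriod :=
  sum_Iio_add_le_sum P.phaseLength_nonneg i

theorem coe_humanStart_add_one (i : Fin n) : (P.humanStart (i + 1) : AddCircle P.perimeter) =
    ((P.humanStart i + P.edgeLength i : ℝ) : AddCircle P.perimeter) :=
  coe_sum_Iio_add_one i

theorem exists_last : ∃ i : Fin n, i + 1 = 0 ∧ P.humanStart i + P.edgeLength i = P.perimeter ∧
    P.puppyStart i + (P.edgeLength i + |P.turn i|) = P.puppyPeriod := by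
  have hn : 0 < n := Nat.pos_of_ne_zero (NeZero.ne n)
  have h : n ≤ (⟨n - 1, by omega⟩ : Fin n).val + 1 := by simp only; omega
  exact ⟨_, Fin.add_one_eq_zero_of_card_le h, Fin.sum_Iio_add_last _ h, Fin.sum_Iio_add_last _ h⟩

section Sums

variable {M : Type*} [AddCommMonoid M]

theorem sum_ramp_human (f : Fin n → ℝ → M) (hf : ∀ i, f i 0 = 0) {i : Fin n} {s : ℝ}
    (h0 : 0 ≤ s) (hs : s ≤ P.edgeLength i) :
    ∑ k, f k (ramp (P.humanStart k) (P.edgeLength k) (P.humanStart i + s)) =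
      ∑ k ∈ Finset.Iio i, f k (P.edgeLength k) + f i s := by
  refine sum_eq_sum_Iio_add i (fun k hk => ?_) ?_ fun k hk => ?_
  · rw [ramp_of_le (P.edgeLength_nonneg k) (by linarith [P.humanStart_add_le hk])]
  · rw [ramp_of_mem (by linarith) (by linarith), add_sub_cancel_left]
  · rw [ramp_of_ge (by linarith [P.humanStart_add_le hk]), hf]

/-- Keeping `f` general covers both the puppy's position and the length it has travelled. -/
theorem sum_ramp_puppy_edge (f : Fin n → ℝ → M) (hf : ∀ i, f i 0 = 0) {i : Fin n} {s : ℝ}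
    (h0 : 0 ≤ s) (hs : s ≤ P.edgeLength i) :
    ∑ k, f k (ramp (P.puppyStart k) (P.edgeLength k) (P.puppyStart i + s)) =
      ∑ k ∈ Finset.Iio i, f k (P.edgeLength k) + f i s := by
  refine sum_eq_sum_Iio_add i (fun k hk => ?_) ?_ fun k hk => ?_
  · rw [ramp_of_le (P.edgeLength_nonneg k)
      (by linarith [P.puppyStart_add_le hk, abs_nonneg (P.turn k)])]
  · rw [ramp_of_mem (by linarith) (by linarith), add_sub_cancel_left]
  · rw [ramp_of_ge (by linarith [P.puppyStart_add_le hk, abs_nonneg (P.turn i)]), hf]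

theorem sum_ramp_puppy_turn (f : Fin n → ℝ → M) (hf : ∀ i, f i 0 = 0) {i : Fin n} {s : ℝ}
    (h0 : 0 ≤ s) (hs : s ≤ |P.turn i|) :
    ∑ k, f k (ramp (P.puppyStart k) (P.edgeLength k) (P.puppyStart i + (P.edgeLength i + s))) =
      ∑ k ∈ Finset.Iio i, f k (P.edgeLength k) + f i (P.edgeLength i) := by
  refine sum_eq_sum_Iio_add i (fun k hk => ?_) ?_ fun k hk => ?_
  · rw [ramp_of_le (P.edgeLength_nonneg k) (by
      linarith [P.puppyStart_add_le hk, abs_nonneg (P.turn k), P.edgeLength_nonneg i])]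
  · rw [ramp_of_le (P.edgeLength_nonneg i) (by linarith)]
  · rw [ramp_of_ge (by linarith [P.puppyStart_add_le hk]), hf]

theorem sum_ramp_dir_edge (f : Fin n → ℝ → M) (hf : ∀ i, f i 0 = 0) {i : Fin n} {s : ℝ}
    (h0 : 0 ≤ s) (hs : s ≤ P.edgeLength i) :
    ∑ k, f k (ramp (P.puppyStart k + P.edgeLength k) |P.turn k| (P.puppyStart i + s)) =
      ∑ k ∈ Finset.Iio i, f k |P.turn k| := by
  rw [← add_zero (∑ k ∈ Finset.Iio i, f k |P.turn k|)]
  refine sum_eq_sum_Iio_add i (fun k hk => ?_) ?_ fun k hk => ?_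
  · rw [ramp_of_le (abs_nonneg _) (by linarith [P.puppyStart_add_le hk])]
  · rw [ramp_of_ge (by linarith), hf]
  · rw [ramp_of_ge (by
      linarith [P.puppyStart_add_le hk, P.edgeLength_nonneg k, abs_nonneg (P.turn i)]), hf]

theorem sum_ramp_dir_turn (f : Fin n → ℝ → M) (hf : ∀ i, f i 0 = 0) {i : Fin n} {s : ℝ}
    (h0 : 0 ≤ s) (hs : s ≤ |P.turn i|) :
    ∑ k, f k (ramp (P.puppyStart k + P.edgeLength k) |P.turn k|
        (P.puppyStart i + (P.edgeLength i + s))) =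
      ∑ k ∈ Finset.Iio i, f k |P.turn k| + f i s := by
  refine sum_eq_sum_Iio_add i (fun k hk => ?_) ?_ fun k hk => ?_
  · rw [ramp_of_le (abs_nonneg _) (by linarith [P.puppyStart_add_le hk, P.edgeLength_nonneg i])]
  · rw [ramp_of_mem (by linarith) (by linarith)]
    congr 1
    ring
  · rw [ramp_of_ge (by linarith [P.puppyStart_add_le hk, P.edgeLength_nonneg k]), hf]

end Sums

/-- The human's position as a function of a real parameter. -/
noncomputable def trackFun (t : ℝ) : ℂ :=
  P.vertices 0 + ∑ i, (ramp (P.humanStart i) (P.edgeLength i) t : ℂ) * P.edgeDir i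

/-- The human's parameter at the place where the puppy is, as a function of a real parameter. -/
noncomputable def collapseFun (t : ℝ) : ℝ := ∑ i, ramp (P.puppyStart i) (P.edgeLength i) t

/-- The puppy's position as a function of a real parameter. -/
noncomputable def puppyPosFun (t : ℝ) : ℂ :=
  P.vertices 0 + ∑ i, (ramp (P.puppyStart i) (P.edgeLength i) t : ℂ) * P.edgeDir i

/-- The puppy's direction as a function of a real parameter. -/
noncomputable def puppyDirFun (t : ℝ) : ℂ :=
  P.edgeDir 0 * Complex.exp (Complex.I * ∑ i, (SignType.sign (P.turn i) *
    ramp (P.puppyStart i + P.edgeLength i) |P.turn i| t : ℝ))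

/-- The puppy's direction after turning for a time `s` at the end of edge `i`. -/
noncomputable def turnDir (i : Fin n) (s : ℝ) : ℂ :=
  P.edgeDir i * Complex.exp (Complex.I * ((SignType.sign (P.turn i) : ℝ) * s : ℝ))

theorem turnDir_zero (i : Fin n) : P.turnDir i 0 = P.edgeDir i := by simp [turnDir]

theorem turnDir_abs_turn (i : Fin n) : P.turnDir i |P.turn i| = P.edgeDir (i + 1) := by
  rw [turnDir, sign_mul_abs_turn, edgeDir_mul_exp_turn]

variable {P} {i : Fin n} {s : ℝ}

theorem trackFun_apply (h0 : 0 ≤ s) (hs : s ≤ P.edgeLength i) :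
    P.trackFun (P.humanStart i + s) = P.vertices i + s * P.edgeDir i := by
  rw [trackFun, P.sum_ramp_human (fun k r => (r : ℂ) * P.edgeDir k) (by simp) h0 hs, ← add_assoc,
    ← vertices_eq_sum]

theorem puppyPosFun_edge (h0 : 0 ≤ s) (hs : s ≤ P.edgeLength i) :
    P.puppyPosFun (P.puppyStart i + s) = P.vertices i + s * P.edgeDir i := by
  rw [puppyPosFun, P.sum_ramp_puppy_edge (fun k r => (r : ℂ) * P.edgeDir k) (by simp) h0 hs,
    ← add_assoc, ← vertices_eq_sum]

theorem puppyPosFun_turn (h0 : 0 ≤ s) (hs : s ≤ |P.turn i|) :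
    P.puppyPosFun (P.puppyStart i + (P.edgeLength i + s)) = P.vertices (i + 1) := by
  rw [puppyPosFun, P.sum_ramp_puppy_turn (fun k r => (r : ℂ) * P.edgeDir k) (by simp) h0 hs,
    ← add_assoc, ← vertices_eq_sum, vertices_add_edge]

theorem collapseFun_edge (h0 : 0 ≤ s) (hs : s ≤ P.edgeLength i) :
    P.collapseFun (P.puppyStart i + s) = P.humanStart i + s :=
  P.sum_ramp_puppy_edge (fun _ r => r) (by simp) h0 hs

theorem collapseFun_turn (h0 : 0 ≤ s) (hs : s ≤ |P.turn i|) :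
    P.collapseFun (P.puppyStart i + (P.edgeLength i + s)) = P.humanStart i + P.edgeLength i :=
  P.sum_ramp_puppy_turn (fun _ r => r) (by simp) h0 hs

theorem puppyDirFun_edge (h0 : 0 ≤ s) (hs : s ≤ P.edgeLength i) :
    P.puppyDirFun (P.puppyStart i + s) = P.edgeDir i := by
  rw [puppyDirFun, P.edgeDir_eq_mul_exp i]
  congr 3
  rw [P.sum_ramp_dir_edge (fun k r => ((SignType.sign (P.turn k) : SignType) : ℝ) * r)
    (by simp) h0 hs]
  congr 1
  exact Finset.sum_congr rfl fun k _ => P.sign_mul_abs_turn k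

theorem puppyDirFun_turn (h0 : 0 ≤ s) (hs : s ≤ |P.turn i|) :
    P.puppyDirFun (P.puppyStart i + (P.edgeLength i + s)) = P.turnDir i s := by
  rw [puppyDirFun, turnDir, P.edgeDir_eq_mul_exp i, mul_assoc, ← Complex.exp_add, ← mul_add]
  congr 3
  rw [← Complex.ofReal_add,
    P.sum_ramp_dir_turn (fun k r => ((SignType.sign (P.turn k) : SignType) : ℝ) * r)
    (by simp) h0 hs]
  congr 2
  exact Finset.sum_congr rfl fun k _ => P.sign_mul_abs_turn k

variable (P)

theorem continuous_trackFun : Continuous P.trackFun := by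
  unfold trackFun
  have := fun i => continuous_ramp (P.humanStart i) (P.edgeLength i)
  fun_prop

theorem continuous_collapseFun : Continuous P.collapseFun := by
  unfold collapseFun
  have := fun i => continuous_ramp (P.puppyStart i) (P.edgeLength i)
  fun_prop

theorem continuous_puppyPosFun : Continuous P.puppyPosFun := by
  unfold puppyPosFun
  have := fun i => continuous_ramp (P.puppyStart i) (P.edgeLength i)
  fun_prop

theorem continuous_puppyDirFun : Continuous P.puppyDirFun := by
  unfold puppyDirFun
  have := fun i => continuous_ramp (P.puppyStart i + P.edgeLength i) |P.turn i|
  fun_prop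

theorem humanStart_zero : P.humanStart 0 = 0 := Fin.sum_Iio_zero _

theorem puppyStart_zero : P.puppyStart 0 = 0 := Fin.sum_Iio_zero _

theorem trackFun_perimeter : P.trackFun 0 = P.trackFun P.perimeter := by
  obtain ⟨i, hi, h, -⟩ := P.exists_last
  have h0 := trackFun_apply (P := P) (i := 0) le_rfl (P.edgeLength_nonneg 0)
  rw [humanStart_zero, zero_add] at h0
  rw [h0, ← h, trackFun_apply (P.edgeLength_nonneg i) le_rfl, vertices_add_edge, hi]
  simp

theorem puppyPosFun_puppyPeriod : P.puppyPosFun 0 = P.puppyPosFun P.puppyPeriod := by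
  obtain ⟨i, hi, -, h⟩ := P.exists_last
  have h0 := puppyPosFun_edge (P := P) (i := 0) le_rfl (P.edgeLength_nonneg 0)
  rw [puppyStart_zero, zero_add] at h0
  rw [h0, ← h, puppyPosFun_turn (abs_nonneg _) le_rfl, hi]
  simp

theorem puppyDirFun_puppyPeriod : P.puppyDirFun 0 = P.puppyDirFun P.puppyPeriod := by
  obtain ⟨i, hi, -, h⟩ := P.exists_last
  have h0 := puppyDirFun_edge (P := P) (i := 0) le_rfl (P.edgeLength_nonneg 0)
  rw [puppyStart_zero, zero_add] at h0
  rw [h0, ← h, puppyDirFun_turn (abs_nonneg _) le_rfl, turnDir_abs_turn, hi]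

theorem collapseFun_zero : P.collapseFun 0 = 0 := by
  have h0 := collapseFun_edge (P := P) (i := 0) le_rfl (P.edgeLength_nonneg 0)
  rwa [puppyStart_zero, zero_add, humanStart_zero, zero_add] at h0

theorem collapseFun_puppyPeriod : P.collapseFun P.puppyPeriod = P.perimeter := by
  obtain ⟨i, hi, h1, h⟩ := P.exists_last
  rw [← h, collapseFun_turn (abs_nonneg _) le_rfl, h1]

/-- The human's parameter at the place where the puppy is. -/
noncomputable def collapse : AddCircle P.puppyPeriod → AddCircle P.perimeter :=
  AddCircle.liftIco P.puppyPeriod 0 fun t => (P.collapseFun t : AddCircle P.perimeter)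

theorem track_coe {t : ℝ} (ht : t ∈ Icc 0 P.perimeter) : P.track t = P.trackFun t :=
  AddCircle.liftIco_zero_coe_apply_of_mem_Icc (f := P.trackFun) P.trackFun_perimeter ht

theorem puppyPos_coe {t : ℝ} (ht : t ∈ Icc 0 P.puppyPeriod) : P.puppyPos t = P.puppyPosFun t :=
  AddCircle.liftIco_zero_coe_apply_of_mem_Icc (f := P.puppyPosFun) P.puppyPosFun_puppyPeriod ht

theorem puppyDir_coe {t : ℝ} (ht : t ∈ Icc 0 P.puppyPeriod) : P.puppyDir t = P.puppyDirFun t :=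
  AddCircle.liftIco_zero_coe_apply_of_mem_Icc (f := P.puppyDirFun) P.puppyDirFun_puppyPeriod ht

theorem coe_collapseFun_puppyPeriod : (P.collapseFun 0 : AddCircle P.perimeter) =
    (P.collapseFun P.puppyPeriod : AddCircle P.perimeter) := by
  rw [collapseFun_zero, collapseFun_puppyPeriod, AddCircle.coe_period, AddCircle.coe_zero]

theorem collapse_coe {t : ℝ} (ht : t ∈ Icc 0 P.puppyPeriod) :
    P.collapse t = (P.collapseFun t : AddCircle P.perimeter) :=
  AddCircle.liftIco_zero_coe_apply_of_mem_Icc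
    (f := fun t => (P.collapseFun t : AddCircle P.perimeter)) P.coe_collapseFun_puppyPeriod ht

theorem continuous_track : Continuous P.track :=
  AddCircle.liftIco_zero_continuous P.trackFun_perimeter P.continuous_trackFun.continuousOn

theorem continuous_puppyPos : Continuous P.puppyPos :=
  AddCircle.liftIco_zero_continuous P.puppyPosFun_puppyPeriod P.continuous_puppyPosFun.continuousOn

theorem continuous_puppyDir : Continuous P.puppyDir :=
  AddCircle.liftIco_zero_continuous P.puppyDirFun_puppyPeriod P.continuous_puppyDirFun.continuousOn

theorem continuous_collapse : Continuous P.collapse :=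
  AddCircle.liftIco_zero_continuous P.coe_collapseFun_puppyPeriod
    ((AddCircle.continuous_mk' _).comp P.continuous_collapseFun).continuousOn

variable {P}

theorem humanStart_add_mem (h0 : 0 ≤ s) (hs : s ≤ P.edgeLength i) :
    P.humanStart i + s ∈ Icc 0 P.perimeter :=
  ⟨add_nonneg (P.humanStart_nonneg i) h0, by linarith [P.humanStart_add_le_perimeter i]⟩

theorem puppyStart_add_mem (h0 : 0 ≤ s) (hs : s ≤ P.edgeLength i + |P.turn i|) :
    P.puppyStart i + s ∈ Icc 0 P.puppyPeriod :=
  ⟨add_nonneg (P.puppyStart_nonneg i) h0, by linarith [P.puppyStart_add_le_puppyPeriod i]⟩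

theorem track_apply (h0 : 0 ≤ s) (hs : s ≤ P.edgeLength i) :
    P.track ((P.humanStart i + s : ℝ) : AddCircle P.perimeter) =
      P.vertices i + s * P.edgeDir i := by
  rw [P.track_coe (humanStart_add_mem h0 hs), trackFun_apply h0 hs]

theorem puppyPos_edge (h0 : 0 ≤ s) (hs : s ≤ P.edgeLength i) :
    P.puppyPos ((P.puppyStart i + s : ℝ) : AddCircle P.puppyPeriod) =
      P.vertices i + s * P.edgeDir i := by
  rw [P.puppyPos_coe (puppyStart_add_mem h0 (by linarith [abs_nonneg (P.turn i)])),
    puppyPosFun_edge h0 hs]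

theorem puppyDir_edge (h0 : 0 ≤ s) (hs : s ≤ P.edgeLength i) :
    P.puppyDir ((P.puppyStart i + s : ℝ) : AddCircle P.puppyPeriod) = P.edgeDir i := by
  rw [P.puppyDir_coe (puppyStart_add_mem h0 (by linarith [abs_nonneg (P.turn i)])),
    puppyDirFun_edge h0 hs]

theorem collapse_edge (h0 : 0 ≤ s) (hs : s ≤ P.edgeLength i) :
    P.collapse ((P.puppyStart i + s : ℝ) : AddCircle P.puppyPeriod) =
      ((P.humanStart i + s : ℝ) : AddCircle P.perimeter) := by
  rw [P.collapse_coe (puppyStart_add_mem h0 (by linarith [abs_nonneg (P.turn i)])),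
    collapseFun_edge h0 hs]

theorem puppyPos_turn (h0 : 0 ≤ s) (hs : s ≤ |P.turn i|) :
    P.puppyPos ((P.puppyStart i + (P.edgeLength i + s) : ℝ) : AddCircle P.puppyPeriod) =
      P.vertices (i + 1) := by
  rw [P.puppyPos_coe (puppyStart_add_mem (add_nonneg (P.edgeLength_nonneg i) h0) (by linarith)),
    puppyPosFun_turn h0 hs]

theorem puppyDir_turn (h0 : 0 ≤ s) (hs : s ≤ |P.turn i|) :
    P.puppyDir ((P.puppyStart i + (P.edgeLength i + s) : ℝ) : AddCircle P.puppyPeriod) =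
      P.turnDir i s := by
  rw [P.puppyDir_coe (puppyStart_add_mem (add_nonneg (P.edgeLength_nonneg i) h0) (by linarith)),
    puppyDirFun_turn h0 hs]

theorem collapse_turn (h0 : 0 ≤ s) (hs : s ≤ |P.turn i|) :
    P.collapse ((P.puppyStart i + (P.edgeLength i + s) : ℝ) : AddCircle P.puppyPeriod) =
      (P.humanStart (i + 1) : AddCircle P.perimeter) := by
  rw [P.collapse_coe (puppyStart_add_mem (add_nonneg (P.edgeLength_nonneg i) h0) (by linarith)),
    collapseFun_turn h0 hs, coe_humanStart_add_one]

variable (P)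

theorem exists_human (x : AddCircle P.perimeter) : ∃ i : Fin n, ∃ s, 0 ≤ s ∧ s < P.edgeLength i ∧
    x = ((P.humanStart i + s : ℝ) : AddCircle P.perimeter) := by
  obtain ⟨t, ht, rfl⟩ := AddCircle.eq_coe_Ico x
  obtain ⟨i, h1, h2⟩ := exists_sum_Iio_le (d := P.edgeLength) ht.1 ht.2
  refine ⟨i, t - P.humanStart i, sub_nonneg.2 h1, sub_lt_iff_lt_add'.2 h2, ?_⟩
  rw [add_sub_cancel]

theorem exists_puppy (y : AddCircle P.puppyPeriod) : ∃ i : Fin n,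
    (∃ s, 0 ≤ s ∧ s ≤ P.edgeLength i ∧
      y = ((P.puppyStart i + s : ℝ) : AddCircle P.puppyPeriod)) ∨
    ∃ s, 0 ≤ s ∧ s ≤ |P.turn i| ∧
      y = ((P.puppyStart i + (P.edgeLength i + s) : ℝ) : AddCircle P.puppyPeriod) := by
  obtain ⟨t, ht, rfl⟩ := AddCircle.eq_coe_Ico y
  obtain ⟨i, h1, h2⟩ := exists_sum_Iio_le (d := P.phaseLength) ht.1 ht.2
  refine ⟨i, ?_⟩
  have h1 : P.puppyStart i ≤ t := h1
  have h2 : t < P.puppyStart i + (P.edgeLength i + |P.turn i|) := h2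
  rcases le_total (t - P.puppyStart i) (P.edgeLength i) with h | h
  · exact Or.inl ⟨t - P.puppyStart i, sub_nonneg.2 h1, h, by rw [add_sub_cancel]⟩
  · exact Or.inr ⟨t - P.puppyStart i - P.edgeLength i, sub_nonneg.2 h, by linarith, by
      congr 1; ring⟩

theorem track_collapse (y : AddCircle P.puppyPeriod) : P.track (P.collapse y) = P.puppyPos y := by
  obtain ⟨i, ⟨s, h0, hs, rfl⟩ | ⟨s, h0, hs, rfl⟩⟩ := P.exists_puppy y
  · rw [collapse_edge h0 hs, puppyPos_edge h0 hs, track_apply h0 hs]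
  · rw [collapse_turn h0 hs, puppyPos_turn h0 hs]
    have := track_apply (P := P) (i := i + 1) le_rfl (P.edgeLength_nonneg _)
    simpa using this

/-- A common point of two different edges is an end point of both. On the half-open parameter ranges
this can only be the initial vertex of each, and the vertices are distinct. -/
theorem track_injective : Function.Injective P.track := by
  intro x x' h
  obtain ⟨i, s, h0, hs, rfl⟩ := P.exists_human x
  obtain ⟨j, r, h0', hr, rfl⟩ := P.exists_human x'
  rw [track_apply h0 hs.le, track_apply h0' hr.le] at h
  have hmem : ∀ (i : Fin n) (s : ℝ), 0 ≤ s → s < P.edgeLength i →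
      P.vertices i + s * P.edgeDir i ∈ segment ℝ (P.vertices i) (P.vertices (i + 1)) := by
    intro i s h0 hs
    refine (segment_eq_image' ℝ (P.vertices i) (P.vertices (i + 1))).symm ▸
      ⟨s / P.edgeLength i, ⟨by have := P.edgeLength_nonneg i; positivity,
        (div_le_one (P.edgeLength_pos i)).2 hs.le⟩, ?_⟩
    have := P.edgeLength_ne_zero i
    rw [edgeDir, edgeVec]
    simp only [Complex.real_smul]
    push_cast
    ring
  have hstart : ∀ (i : Fin n) (s : ℝ), 0 ≤ s → s < P.edgeLength i →
      P.vertices i + s * P.edgeDir i ∈ ({P.vertices i, P.vertices (i + 1)} : Set ℂ) → s = 0 := by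
    intro i s h0 hs hv
    rcases hv with hv | hv
    · have h1 : (s : ℂ) * P.edgeDir i = 0 := by simpa using hv
      have h2 := congrArg norm h1
      rw [norm_mul, norm_edgeDir, norm_zero, mul_one, Complex.norm_real, norm_eq_zero] at h2
      exact h2
    · exfalso
      rw [mem_singleton_iff, ← vertices_add_edge] at hv
      have h1 : ((s - P.edgeLength i : ℝ) : ℂ) * P.edgeDir i = 0 := by
        push_cast
        linear_combination hv
      have h2 := congrArg norm h1
      rw [norm_mul, norm_edgeDir, norm_zero, mul_one, Complex.norm_real, norm_eq_zero] at h2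
      linarith
  by_cases hij : i = j
  · subst hij
    have h1 : ((s - r : ℝ) : ℂ) * P.edgeDir i = 0 := by
      push_cast
      linear_combination h
    have h2 := congrArg norm h1
    rw [norm_mul, norm_edgeDir, norm_zero, mul_one, Complex.norm_real, norm_eq_zero] at h2
    rw [sub_eq_zero.1 h2]
  · have h1 := P.edges_inter i j hij ⟨hmem i s h0 hs, h ▸ hmem j r h0' hr⟩
    have hs0 := hstart i s h0 hs h1.1
    have hr0 := hstart j r h0' hr (h ▸ h1.2)
    subst hs0 hr0
    exact absurd (P.vertices_injective (by simpa using h)) hij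

end SimplePolygon

end

/-! ### Zero sets on a torus that are locally graphs. -/

section

open Topology Filter Set

section LocalArc

theorem mul_neg_of_injOn {f : ℝ → ℝ} {a b c : ℝ} (hc : c ∈ Ioo a b)
    (hf : ContinuousOn f (Icc a b)) (hinj : InjOn f (Icc a b)) (h0 : f c = 0) : f a * f b < 0 := by
  have hab : a ≤ b := (hc.1.trans hc.2).le
  have hcI : c ∈ Icc a b := Ioo_subset_Icc_self hc
  rcases hf.strictMonoOn_of_injOn_Icc' hab hinj with h | h
  · have h1 := h (left_mem_Icc.2 hab) hcI hc.1
    have h2 := h hcI (right_mem_Icc.2 hab) hc.2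
    rw [h0] at h1 h2
    exact mul_neg_of_neg_of_pos h1 h2
  · have h1 := h (left_mem_Icc.2 hab) hcI hc.1
    have h2 := h hcI (right_mem_Icc.2 hab) hc.2
    rw [h0] at h1 h2
    exact mul_neg_of_pos_of_neg h1 h2

theorem exists_zero_of_mul_neg {f : ℝ → ℝ} {a b : ℝ} (hab : a ≤ b) (hf : ContinuousOn f (Icc a b))
    (h : f a * f b < 0) : ∃ c ∈ Ioo a b, f c = 0 := by
  rcases mul_neg_iff.1 h with h | h
  · exact intermediate_value_Ioo' hab hf (mem_Ioo.2 ⟨h.2, h.1⟩)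
  · exact intermediate_value_Ioo hab hf h

/-- If a continuous function of two variables is injective in the second one, its zero set is
locally a graph. -/
theorem exists_graph_of_injOn {f : ℝ × ℝ → ℝ} (hf : Continuous f) {x₀ y₀ ε : ℝ} (hε : 0 < ε)
    (hinj : ∀ x ∈ Ioo (x₀ - ε) (x₀ + ε), InjOn (fun y => f (x, y)) (Ioo (y₀ - ε) (y₀ + ε)))
    (h0 : f (x₀, y₀) = 0) {B : ℝ} (hB : 0 < B) :
    ∃ δ, 0 < δ ∧ δ ≤ B ∧ ∃ η, 0 < η ∧ ∃ g : ℝ → ℝ, ContinuousOn g (Ioo (x₀ - δ) (x₀ + δ)) ∧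
      g x₀ = y₀ ∧ ∀ x ∈ Ioo (x₀ - δ) (x₀ + δ), g x ∈ Ioo (y₀ - η) (y₀ + η) ∧ f (x, g x) = 0 ∧
        ∀ y ∈ Ioo (y₀ - η) (y₀ + η), f (x, y) = 0 → y = g x := by
  have hfy : ∀ x, Continuous fun y => f (x, y) := fun x => hf.comp (by fun_prop)
  -- An injective continuous function changes sign at its zero, and the sign change survives for
  -- nearby `x`. This yields the existence of `g` and, on shrinking windows, its continuity; no
  -- differentiability is needed.
  have key : ∀ x ∈ Ioo (x₀ - ε) (x₀ + ε), ∀ a b c, y₀ - ε < a → b < y₀ + ε → c ∈ Ioo a b →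
      f (x, c) = 0 → ∀ᶠ x' in 𝓝 x, ∃ c' ∈ Ioo a b, f (x', c') = 0 := by
    intro x hx a b c ha hb hc hfc
    have hab := hc.1.trans hc.2
    have h1 := mul_neg_of_injOn (f := fun y => f (x, y)) hc (hfy x).continuousOn
      ((hinj x hx).mono (Icc_subset_Ioo ha hb)) hfc
    have h2 : ContinuousAt (fun x' => f (x', a) * f (x', b)) x := by
      apply Continuous.continuousAt
      exact (hf.comp (by fun_prop)).mul (hf.comp (by fun_prop))
    filter_upwards [h2.eventually_lt continuousAt_const h1] with x' hx'
    exact exists_zero_of_mul_neg hab.le (hfy x').continuousOn hx'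
  have hx₀ : x₀ ∈ Ioo (x₀ - ε) (x₀ + ε) := ⟨by linarith, by linarith⟩
  set η := ε / 2
  have hη : 0 < η := half_pos hε
  have hηε : η < ε := half_lt_self hε
  obtain ⟨δ₀, hδ₀, hball⟩ := Metric.eventually_nhds_iff_ball.1
    (key x₀ hx₀ (y₀ - η) (y₀ + η) y₀ (by linarith) (by linarith) ⟨by linarith, by linarith⟩ h0)
  rw [Real.ball_eq_Ioo] at hball
  set δ := min (min δ₀ ε) B
  have hδ : 0 < δ := lt_min (lt_min hδ₀ hε) hB
  have hδ1 : δ ≤ δ₀ := (min_le_left _ _).trans (min_le_left _ _)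
  have hδ2 : δ ≤ ε := (min_le_left _ _).trans (min_le_right _ _)
  have hball' : ∀ x ∈ Ioo (x₀ - δ) (x₀ + δ), ∃ c ∈ Ioo (y₀ - η) (y₀ + η), f (x, c) = 0 :=
    fun x hx => hball x ⟨by linarith [hx.1], by linarith [hx.2]⟩
  choose! g hg hg0 using hball'
  have hsub : ∀ x ∈ Ioo (x₀ - δ) (x₀ + δ), x ∈ Ioo (x₀ - ε) (x₀ + ε) :=
    fun x hx => ⟨by linarith [hx.1], by linarith [hx.2]⟩
  have huniq : ∀ x ∈ Ioo (x₀ - δ) (x₀ + δ), ∀ y ∈ Ioo (y₀ - η) (y₀ + η), f (x, y) = 0 →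
      y = g x := fun x hx y hy h =>
    hinj x (hsub x hx) ⟨by linarith [hy.1], by linarith [hy.2]⟩
      ⟨by linarith [(hg x hx).1], by linarith [(hg x hx).2]⟩ (h.trans (hg0 x hx).symm)
  refine ⟨δ, hδ, min_le_right _ _, η, hη, g, ?_, ?_, fun x hx => ⟨hg x hx, hg0 x hx, huniq x hx⟩⟩
  · intro x hx
    apply ContinuousAt.continuousWithinAt
    rw [Metric.continuousAt_iff']
    intro r hr
    have hgx := hg x hx
    have h1 := key x (hsub x hx) (max (g x - r) (y₀ - η)) (min (g x + r) (y₀ + η)) (g x)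
      (lt_max_of_lt_right (by linarith)) (min_lt_of_right_lt (by linarith))
      ⟨max_lt (by linarith) hgx.1, lt_min (by linarith) hgx.2⟩ (hg0 x hx)
    filter_upwards [h1, Ioo_mem_nhds hx.1 hx.2] with x' ⟨c, hc, hfc⟩ hx'
    have := huniq x' hx' c ⟨(le_max_right _ _).trans_lt hc.1, hc.2.trans_le (min_le_right _ _)⟩ hfc
    rw [← this, Real.dist_eq, abs_lt]
    constructor
    · linarith [(le_max_left (g x - r) (y₀ - η)).trans_lt hc.1]
    · linarith [hc.2.trans_le (min_le_left (g x + r) (y₀ + η))]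
  · exact (huniq x₀ ⟨by linarith, by linarith⟩ y₀ ⟨by linarith, by linarith⟩ h0).symm

/-- A subset of a space is an open arc of that subset around the point `z`. -/
def HasArcAt {X : Type*} [TopologicalSpace X] (Z : Set X) (z : X) : Prop :=
  ∃ ψ : ℝ → X, Continuous ψ ∧ Function.Injective ψ ∧ ψ 0 = z ∧
    ∀ V : Set ℝ, IsOpen V → ∃ O : Set X, IsOpen O ∧ ψ '' V = Z ∩ O

theorem HasArcAt.preimage {X Y : Type*} [TopologicalSpace X] [TopologicalSpace Y] {Z : Set X}
    {z : X} (h : HasArcAt Z z) (e : Y ≃ₜ X) : HasArcAt (e ⁻¹' Z) (e.symm z) := by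
  obtain ⟨ψ, hc, hi, h0, ho⟩ := h
  refine ⟨e.symm ∘ ψ, e.symm.continuous.comp hc, e.symm.injective.comp hi, congrArg e.symm h0,
    fun V hV => ?_⟩
  obtain ⟨O, hO, hVO⟩ := ho V hV
  exact ⟨e ⁻¹' O, hO.preimage e.continuous, by
    rw [image_comp, hVO, e.symm.image_eq_preimage_symm, e.symm_symm, preimage_inter]⟩

/-- An arc through a point is connected, so it stays in the component of that point; being
relatively open in `Z`, it is open in the component. -/
theorem locallyArc_of_hasArcAt {X : Type*} [TopologicalSpace X] {Z : Set X} {c : X}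
    (h : ∀ z ∈ connectedComponentIn Z c, HasArcAt Z z) :
    LocallyArc (connectedComponentIn Z c) := by
  rintro ⟨z, hz⟩
  obtain ⟨ψ, hc, hi, h0, ho⟩ := h z hz
  have hZ : range ψ ⊆ Z := by
    obtain ⟨O, -, hO⟩ := ho univ isOpen_univ
    rw [← image_univ, hO]
    exact inter_subset_left
  have hsub : ∀ t, ψ t ∈ connectedComponentIn Z c := fun t => by
    rw [connectedComponentIn_eq hz]
    exact (isPreconnected_range hc).subset_connectedComponentIn ⟨0, h0⟩ hZ ⟨t, rfl⟩
  refine ⟨fun t => ⟨ψ t, hsub t⟩, .of_continuous_injective_isOpenMap (hc.subtype_mk _)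
    (fun s t hst => hi (congrArg Subtype.val hst)) fun V hV => ?_, Subtype.ext h0⟩
  obtain ⟨O, hO, hVO⟩ := ho V hV
  refine ⟨O, hO, ?_⟩
  ext ⟨w, hw⟩
  constructor
  · intro hwO
    obtain ⟨t, ht, rfl⟩ : w ∈ ψ '' V := hVO ▸ ⟨connectedComponentIn_subset Z c hw, hwO⟩
    exact ⟨t, ht, rfl⟩
  · rintro ⟨t, ht, h⟩
    have : w ∈ Z ∩ O := hVO ▸ ⟨t, ht, congrArg Subtype.val h⟩
    exact this.2

variable {S T : ℝ}

theorem hasArcAt_of_injOn [hS : Fact (0 < S)] {F : AddCircle S × AddCircle T → ℝ}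
    (hF : Continuous F) {x₀ y₀ ε : ℝ}
    (hε : 0 < ε) (hinj : ∀ x ∈ Ioo (x₀ - ε) (x₀ + ε),
      InjOn (fun y : ℝ => F ((x : AddCircle S), (y : AddCircle T))) (Ioo (y₀ - ε) (y₀ + ε)))
    (h0 : F ((x₀ : AddCircle S), (y₀ : AddCircle T)) = 0) :
    HasArcAt {c | F c = 0} ((x₀ : AddCircle S), (y₀ : AddCircle T)) := by
  have hcS := AddCircle.continuous_mk' S
  have hcT := AddCircle.continuous_mk' T
  have hf : Continuous fun z : ℝ × ℝ => F ((z.1 : AddCircle S), (z.2 : AddCircle T)) :=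
    hF.comp ((hcS.comp continuous_fst).prodMk (hcT.comp continuous_snd))
  obtain ⟨δ, hδ, hδS, η, hη, g, hgc, hg0, hg⟩ := exists_graph_of_injOn hf hε hinj h0
    (half_pos hS.out)
  have hpi := Real.pi_pos
  -- This stretches the domain of the graph to ℝ. As `δ ≤ S / 2`, that domain embeds in the circle.
  set ρ : ℝ → ℝ := fun t => x₀ + δ * (2 / Real.pi * Real.arctan t) with hρ
  have hρc : Continuous ρ := by
    have := Real.continuous_arctan
    fun_prop
  have hρmem : ∀ t, ρ t ∈ Ioo (x₀ - δ) (x₀ + δ) := by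
    intro t
    have h1 : 2 / Real.pi * Real.arctan t < 1 := by
      rw [div_mul_eq_mul_div, div_lt_one hpi]
      linarith [Real.arctan_lt_pi_div_two t]
    have h2 : -1 < 2 / Real.pi * Real.arctan t := by
      rw [div_mul_eq_mul_div, lt_div_iff₀ hpi]
      linarith [Real.neg_pi_div_two_lt_arctan t]
    constructor <;> simp only [hρ] <;> nlinarith
  have hρi : Function.Injective ρ := by
    intro s t hst
    have h1 : 2 / Real.pi ≠ 0 := by positivity
    exact Real.arctan_injective (mul_left_cancel₀ h1 (mul_left_cancel₀ hδ.ne' (add_left_cancel hst)))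
  have hρo : IsOpenMap ρ := by
    have h : IsOpenEmbedding ρ := LocallyArc.isOpenEmbedding
      (fun z => ⟨fun t => t + z, (Homeomorph.addRight z).isOpenEmbedding, zero_add z⟩) hρc hρi
    exact h.isOpenMap
  refine ⟨fun t => ((ρ t : AddCircle S), (g (ρ t) : AddCircle T)), ?_, ?_, ?_, fun V hV => ?_⟩
  · exact (hcS.comp hρc).prodMk (hcT.comp (hgc.comp_continuous hρc hρmem))
  · intro s t hst
    have h1 : (ρ s : AddCircle S) = ρ t := congrArg Prod.fst hst
    have hI : ∀ r, ρ r ∈ Ico (x₀ - δ) (x₀ - δ + S) := fun r =>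
      ⟨(hρmem r).1.le, by linarith [(hρmem r).2]⟩
    exact hρi ((AddCircle.coe_eq_coe_iff_of_mem_Ico (hI s) (hI t)).1 h1)
  · simp [hρ, hg0]
  · refine ⟨((fun x : ℝ => (x : AddCircle S)) '' (ρ '' V)) ×ˢ
      ((fun x : ℝ => (x : AddCircle T)) '' Ioo (y₀ - η) (y₀ + η)),
      (QuotientAddGroup.isOpenMap_coe _ (hρo V hV)).prod
        (QuotientAddGroup.isOpenMap_coe _ isOpen_Ioo), ?_⟩
    ext ⟨a, b⟩
    constructor
    · rintro ⟨t, ht, h⟩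
      rw [Prod.mk.injEq] at h
      obtain ⟨rfl, rfl⟩ := h
      obtain ⟨h1, h2, -⟩ := hg (ρ t) (hρmem t)
      exact ⟨h2, ⟨_, ⟨t, ht, rfl⟩, rfl⟩, ⟨_, h1, rfl⟩⟩
    · rintro ⟨h, ⟨_, ⟨t, ht, rfl⟩, rfl⟩, ⟨y, hy, rfl⟩⟩
      have := (hg (ρ t) (hρmem t)).2.2 y hy h
      subst this
      exact ⟨t, ht, rfl⟩

theorem hasArcAt_of_injOn_left [hT : Fact (0 < T)] {F : AddCircle S × AddCircle T → ℝ}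
    (hF : Continuous F) {x₀ y₀ ε : ℝ} (hε : 0 < ε) (hinj : ∀ y ∈ Ioo (y₀ - ε) (y₀ + ε),
      InjOn (fun x : ℝ => F ((x : AddCircle S), (y : AddCircle T))) (Ioo (x₀ - ε) (x₀ + ε)))
    (h0 : F ((x₀ : AddCircle S), (y₀ : AddCircle T)) = 0) :
    HasArcAt {c | F c = 0} ((x₀ : AddCircle S), (y₀ : AddCircle T)) :=
  (hasArcAt_of_injOn (F := F ∘ Prod.swap) (hF.comp continuous_swap) hε hinj h0).preimage
    (Homeomorph.prodComm (AddCircle S) (AddCircle T))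

end LocalArc

end

/-! ### Local structure of the attraction diagram. -/

section

open Topology Filter Set

namespace SimplePolygon

variable {n : ℕ} [NeZero n] (P : SimplePolygon n)

theorem inner_ofReal_mul_left (r : ℝ) (z w : ℂ) : inner ℝ ((r : ℂ) * z) w = r * inner ℝ z w := by
  rw [← Complex.real_smul, real_inner_smul_left]

theorem add_one_ne_self (P : SimplePolygon n) (i : Fin n) : i + 1 ≠ i := by
  intro h
  have h3 := P.three_le
  have h1 : (1 : Fin n) = 0 := by simpa using h
  have h4 := congrArg Fin.val h1
  rw [Fin.val_one', Fin.val_zero, Nat.mod_eq_of_lt (by omega)] at h4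
  exact one_ne_zero h4

theorem add_one_add_one_ne_self (P : SimplePolygon n) (i : Fin n) : i + 1 + 1 ≠ i := by
  intro h
  have h3 := P.three_le
  have h1 : (1 + 1 : Fin n) = 0 := by
    rw [add_assoc] at h
    simpa using h
  have h4 := congrArg Fin.val h1
  rw [Fin.val_add, Fin.val_one', Fin.val_zero, Nat.mod_eq_of_lt (show 1 < n by omega),
    Nat.mod_eq_of_lt (by omega)] at h4
  omega

theorem vertexAngle_add_one (i : Fin n) : P.vertexAngle (i + 1) = Real.pi - |P.turn i| := by
  rw [vertexAngle, add_sub_cancel_right, EuclideanGeometry.angle, turn,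
    ← Complex.angle_eq_abs_arg (P.edgeVec_ne_zero _) (P.edgeVec_ne_zero _),
    InnerProductGeometry.angle_comm (P.edgeVec (i + 1)), ← InnerProductGeometry.angle_neg_left]
  simp only [edgeVec, vsub_eq_sub, neg_sub]

variable {P}

/-- The assumption on acute angles enters only here; the absence of right angles makes the bound
strict. -/
theorem abs_turn_lt (hacute : P.NoAcuteVertexAngle) (hright : P.NoRightAngle) (i : Fin n) :
    |P.turn i| < Real.pi / 2 := by
  have h1 := hacute (i + 1)
  have h2 := hright i (i + 1) (i + 1 + 1) (P.add_one_ne_self i).symm (P.add_one_ne_self _).symm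
    (P.add_one_add_one_ne_self i).symm
  have h3 : P.vertexAngle (i + 1) ≠ Real.pi / 2 := by
    rwa [vertexAngle, add_sub_cancel_right]
  have h4 := lt_of_le_of_ne h1 h3.symm
  rw [vertexAngle_add_one] at h4
  linarith

/-- Orthogonality would be a right angle at vertex `k`, or a degenerate edge if `m = k + 1`. This
serves a puppy about to walk along edge `k`; the primed version serves one that has just finished
it. -/
theorem inner_vertices_sub_edgeVec_ne_zero (hright : P.NoRightAngle) {m k : Fin n} (hmk : m ≠ k) :
    inner ℝ (P.vertices m - P.vertices k) (P.edgeDir k) ≠ 0 := by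
  intro h
  have h1 : inner ℝ (P.vertices m - P.vertices k) (P.vertices (k + 1) - P.vertices k) = 0 := by
    change inner ℝ _ (P.edgeVec k) = 0
    rw [← edgeLength_mul_edgeDir, ← Complex.real_smul, real_inner_smul_right, h, mul_zero]
  by_cases hm : m = k + 1
  · subst hm
    exact P.edgeVec_ne_zero k (inner_self_eq_zero.1 h1)
  · exact hright m k (k + 1) hmk (P.add_one_ne_self k).symm hm
      (InnerProductGeometry.inner_eq_zero_iff_angle_eq_pi_div_two _ _ |>.1 h1)

theorem inner_vertices_sub_edgeVec_ne_zero' (hright : P.NoRightAngle) {m k : Fin n}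
    (hmk : m ≠ k + 1) : inner ℝ (P.vertices m - P.vertices (k + 1)) (P.edgeDir k) ≠ 0 := by
  intro h
  have h1 : inner ℝ (P.vertices m - P.vertices (k + 1)) (P.vertices k - P.vertices (k + 1)) = 0 := by
    rw [show P.vertices k - P.vertices (k + 1) = -P.edgeVec k by rw [edgeVec]; ring,
      ← edgeLength_mul_edgeDir, ← Complex.real_smul, inner_neg_right, real_inner_smul_right, h,
      mul_zero, neg_zero]
  by_cases hm : m = k
  · subst hm
    exact sub_ne_zero.2 (P.vertices_injective.ne hmk) (inner_self_eq_zero.1 h1)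
  · exact hright m (k + 1) k hmk (P.add_one_ne_self k) hm
      (InnerProductGeometry.inner_eq_zero_iff_angle_eq_pi_div_two _ _ |>.1 h1)

variable (P)

theorem turnDir_eq (i : Fin n) (s : ℝ) : P.turnDir i s =
    Real.cos ((SignType.sign (P.turn i) : ℝ) * s) • P.edgeDir i +
      Real.sin ((SignType.sign (P.turn i) : ℝ) * s) • (Complex.I * P.edgeDir i) := by
  rw [turnDir, mul_comm Complex.I, Complex.exp_mul_I, ← Complex.ofReal_cos, ← Complex.ofReal_sin,
    Complex.real_smul, Complex.real_smul]
  ring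

theorem inner_edgeDir_self (i : Fin n) : inner ℝ (P.edgeDir i) (P.edgeDir i) = 1 := by
  rw [real_inner_self_eq_norm_sq, norm_edgeDir, one_pow]

theorem inner_I_mul_self (z : ℂ) : inner ℝ z (Complex.I * z) = 0 := by
  rw [Complex.inner, Complex.mul_re, Complex.mul_re, Complex.mul_im]
  simp
  ring

theorem inner_turnDir_turnDir (i : Fin n) (r s : ℝ) : inner ℝ (P.turnDir i r) (P.turnDir i s) =
    Real.cos ((SignType.sign (P.turn i) : ℝ) * (r - s)) := by
  have h1 := P.inner_edgeDir_self i
  have h2 := inner_I_mul_self (P.edgeDir i)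
  have h3 : inner ℝ (Complex.I * P.edgeDir i) (P.edgeDir i) = 0 := by rw [real_inner_comm, h2]
  have h4 : inner ℝ (Complex.I * P.edgeDir i) (Complex.I * P.edgeDir i) = 1 := by
    rw [real_inner_self_eq_norm_sq, norm_mul, Complex.norm_I, norm_edgeDir]
    norm_num
  rw [turnDir_eq, turnDir_eq, inner_add_left, inner_add_right, inner_add_right]
  simp only [real_inner_smul_left, real_inner_smul_right, h1, h2, h3, h4]
  rw [mul_sub, Real.cos_sub]
  ring

theorem abs_sign_mul_le (a x : ℝ) : |((SignType.sign a : SignType) : ℝ) * x| ≤ |x| := by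
  rw [abs_mul]
  refine mul_le_of_le_one_left (abs_nonneg x) ?_
  rcases lt_trichotomy a 0 with h | h | h <;> simp [h]

variable {P}

theorem inner_turnDir_pos (hlt : ∀ i, |P.turn i| < Real.pi / 2) {i : Fin n} {r s : ℝ}
    (hr0 : 0 ≤ r) (hr : r ≤ |P.turn i|) (hs0 : 0 ≤ s) (hs : s ≤ |P.turn i|) :
    0 < inner ℝ (P.turnDir i r) (P.turnDir i s) := by
  rw [inner_turnDir_turnDir]
  have h1 := (abs_sign_mul_le (P.turn i) (r - s)).trans_lt
    ((abs_le.2 ⟨by linarith, by linarith⟩ : |r - s| ≤ |P.turn i|).trans_lt (hlt i))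
  exact Real.cos_pos_of_mem_Ioo (abs_lt.1 h1)

theorem inner_edgeDir_turnDir_pos (hlt : ∀ i, |P.turn i| < Real.pi / 2) {i : Fin n} {s : ℝ}
    (hs0 : 0 ≤ s) (hs : s ≤ |P.turn i|) : 0 < inner ℝ (P.edgeDir i) (P.turnDir i s) := by
  have := inner_turnDir_pos hlt le_rfl (abs_nonneg _) hs0 hs
  rwa [turnDir_zero] at this

theorem inner_edgeDir_add_one_turnDir_pos (hlt : ∀ i, |P.turn i| < Real.pi / 2) {i : Fin n}
    {s : ℝ} (hs0 : 0 ≤ s) (hs : s ≤ |P.turn i|) :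
    0 < inner ℝ (P.edgeDir (i + 1)) (P.turnDir i s) := by
  have := inner_turnDir_pos hlt (abs_nonneg _) le_rfl hs0 hs
  rwa [turnDir_abs_turn] at this

variable (P)

/-- The function whose zero set is the attraction diagram. -/
noncomputable def critFun (c : P.Torus) : ℝ :=
  inner ℝ (P.track c.1 - P.puppyPos c.2) (P.puppyDir c.2)

theorem continuous_critFun : Continuous P.critFun :=
  ((P.continuous_track.comp continuous_fst).sub
    (P.continuous_puppyPos.comp continuous_snd)).inner (P.continuous_puppyDir.comp continuous_snd)

theorem isClosed_attractionDiagram : IsClosed P.attractionDiagram :=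
  isClosed_eq P.continuous_critFun continuous_const

theorem track_eq_puppyPos_iff (c : P.Torus) :
    P.track c.1 = P.puppyPos c.2 ↔ c.1 = P.collapse c.2 := by
  rw [← track_collapse]
  exact P.track_injective.eq_iff

variable {P}

/-- As `u` is at most every edge length, the human has passed at most one vertex. The displacement
is a nonnegative combination of the directions of the current and the next edge, which make acute
angles with the puppy's direction. -/
theorem critFun_ahead (hlt : ∀ i, |P.turn i| < Real.pi / 2) {u : ℝ} (hu0 : 0 < u)
    (hu : ∀ i, u ≤ P.edgeLength i) (y : AddCircle P.puppyPeriod) :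
    0 < P.critFun (P.collapse y + (u : AddCircle P.perimeter), y) := by
  rw [critFun]
  obtain ⟨i, ⟨s, h0, hs, rfl⟩ | ⟨s, h0, hs, rfl⟩⟩ := P.exists_puppy y
  · simp only
    rw [collapse_edge h0 hs, puppyPos_edge h0 hs, puppyDir_edge h0 hs, ← AddCircle.coe_add]
    rcases le_total (s + u) (P.edgeLength i) with h | h
    · rw [add_assoc, track_apply (by linarith) h]
      rw [show P.vertices i + ((s + u : ℝ) : ℂ) * P.edgeDir i - (P.vertices i + s * P.edgeDir i) =
        (u : ℂ) * P.edgeDir i by push_cast; ring, inner_ofReal_mul_left, inner_edgeDir_self, mul_one]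
      exact hu0
    · have h1 : ((P.humanStart i + s + u : ℝ) : AddCircle P.perimeter) =
          ((P.humanStart (i + 1) + (s + u - P.edgeLength i) : ℝ) : AddCircle P.perimeter) := by
        rw [AddCircle.coe_add _ (P.humanStart (i + 1)), coe_humanStart_add_one, ← AddCircle.coe_add]
        congr 1
        ring
      rw [h1, track_apply (by linarith) (by linarith [hu (i + 1)]), ← vertices_add_edge]
      rw [show P.vertices i + P.edgeLength i * P.edgeDir i +
        ((s + u - P.edgeLength i : ℝ) : ℂ) * P.edgeDir (i + 1) - (P.vertices i + s * P.edgeDir i) =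
        ((P.edgeLength i - s : ℝ) : ℂ) * P.edgeDir i +
          ((s + u - P.edgeLength i : ℝ) : ℂ) * P.edgeDir (i + 1) by push_cast; ring,
        inner_add_left, inner_ofReal_mul_left, inner_ofReal_mul_left, inner_edgeDir_self]
      have h2 := inner_edgeDir_add_one_turnDir_pos hlt (i := i) le_rfl (abs_nonneg _)
      rw [turnDir_zero] at h2
      rcases eq_or_lt_of_le hs with h3 | h3
      · rw [h3]
        have : 0 < u * inner ℝ (P.edgeDir (i + 1)) (P.edgeDir i) := mul_pos hu0 h2
        simpa using this
      · have : 0 ≤ (s + u - P.edgeLength i) * inner ℝ (P.edgeDir (i + 1)) (P.edgeDir i) :=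
          mul_nonneg (by linarith) h2.le
        linarith
  · simp only
    rw [collapse_turn h0 hs, puppyPos_turn h0 hs, puppyDir_turn h0 hs, ← AddCircle.coe_add,
      track_apply hu0.le (hu _), add_sub_cancel_left, inner_ofReal_mul_left]
    exact mul_pos hu0 (inner_edgeDir_add_one_turnDir_pos hlt h0 hs)

theorem critFun_behind (hlt : ∀ i, |P.turn i| < Real.pi / 2) {u : ℝ} (hu0 : 0 < u)
    (hu : ∀ i, u ≤ P.edgeLength i) (y : AddCircle P.puppyPeriod) :
    P.critFun (P.collapse y - (u : AddCircle P.perimeter), y) < 0 := by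
  rw [critFun]
  obtain ⟨i, ⟨s, h0, hs, rfl⟩ | ⟨s, h0, hs, rfl⟩⟩ := P.exists_puppy y
  · simp only
    rw [collapse_edge h0 hs, puppyPos_edge h0 hs, puppyDir_edge h0 hs, ← AddCircle.coe_sub]
    rcases le_total 0 (s - u) with h | h
    · rw [add_sub_assoc, track_apply h (by linarith)]
      rw [show P.vertices i + ((s - u : ℝ) : ℂ) * P.edgeDir i - (P.vertices i + s * P.edgeDir i) =
        ((-u : ℝ) : ℂ) * P.edgeDir i by push_cast; ring, inner_ofReal_mul_left, inner_edgeDir_self,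
        mul_one]
      linarith
    · obtain ⟨j, rfl⟩ : ∃ j, i = j + 1 := ⟨i - 1, (sub_add_cancel i 1).symm⟩
      have h1 : ((P.humanStart (j + 1) + s - u : ℝ) : AddCircle P.perimeter) =
          ((P.humanStart j + (P.edgeLength j + s - u) : ℝ) : AddCircle P.perimeter) := by
        rw [show P.humanStart (j + 1) + s - u = P.humanStart (j + 1) + (s - u) by ring,
          AddCircle.coe_add, coe_humanStart_add_one, ← AddCircle.coe_add]
        congr 1
        ring
      rw [h1, track_apply (by linarith [hu j]) (by linarith), ← vertices_add_edge]
      rw [show P.vertices j + ((P.edgeLength j + s - u : ℝ) : ℂ) * P.edgeDir j -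
        (P.vertices j + P.edgeLength j * P.edgeDir j + s * P.edgeDir (j + 1)) =
        ((s - u : ℝ) : ℂ) * P.edgeDir j + ((-s : ℝ) : ℂ) * P.edgeDir (j + 1) by push_cast; ring,
        inner_add_left, inner_ofReal_mul_left, inner_ofReal_mul_left, inner_edgeDir_self]
      have h2 := inner_edgeDir_add_one_turnDir_pos hlt (i := j) le_rfl (abs_nonneg _)
      rw [turnDir_zero, real_inner_comm] at h2
      rcases eq_or_lt_of_le h0 with h3 | h3
      · rw [← h3]
        have : 0 < u * inner ℝ (P.edgeDir j) (P.edgeDir (j + 1)) := mul_pos hu0 h2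
        simpa using this
      · have : 0 ≤ (u - s) * inner ℝ (P.edgeDir j) (P.edgeDir (j + 1)) :=
          mul_nonneg (by linarith) h2.le
        linarith
  · simp only
    have h1 : (P.humanStart (i + 1) : AddCircle P.perimeter) - (u : AddCircle P.perimeter) =
        ((P.humanStart i + (P.edgeLength i - u) : ℝ) : AddCircle P.perimeter) := by
      rw [coe_humanStart_add_one, ← AddCircle.coe_sub]
      congr 1
      ring
    rw [collapse_turn h0 hs, puppyPos_turn h0 hs, puppyDir_turn h0 hs, h1,
      track_apply (by linarith [hu i]) (by linarith), ← vertices_add_edge]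
    rw [show P.vertices i + ((P.edgeLength i - u : ℝ) : ℂ) * P.edgeDir i -
      (P.vertices i + P.edgeLength i * P.edgeDir i) = ((-u : ℝ) : ℂ) * P.edgeDir i by
        push_cast; ring, inner_ofReal_mul_left]
    have := mul_pos hu0 (inner_edgeDir_turnDir_pos hlt h0 hs)
    linarith

variable (P) in
theorem exists_le_edgeLength : ∃ δ, 0 < δ ∧ ∀ i, δ ≤ P.edgeLength i := by
  obtain ⟨i, -, hi⟩ := Finset.exists_min_image Finset.univ P.edgeLength ⟨0, Finset.mem_univ _⟩
  exact ⟨P.edgeLength i, P.edgeLength_pos i, fun j => hi j (Finset.mem_univ j)⟩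

/-- Away from the diagonal, the attraction diagram is a curve, seen from a puppy in the interior
of an edge. -/
theorem hasArcAt_of_edge {x : AddCircle P.perimeter} {i : Fin n} {s : ℝ} (h0 : 0 < s)
    (hs : s < P.edgeLength i)
    (hz : P.critFun (x, ((P.puppyStart i + s : ℝ) : AddCircle P.puppyPeriod)) = 0) :
    HasArcAt P.attractionDiagram (x, ((P.puppyStart i + s : ℝ) : AddCircle P.puppyPeriod)) := by
  obtain ⟨x, rfl⟩ := QuotientAddGroup.mk_surjective x
  refine hasArcAt_of_injOn P.continuous_critFun (x₀ := x)
    (lt_min h0 (sub_pos.2 hs)) (fun x' _ => ?_) hz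
  -- While the puppy walks, the critical function is affine in its parameter, with slope −1.
  have key : ∀ t ∈ Ioo (P.puppyStart i + s - min s (P.edgeLength i - s))
      (P.puppyStart i + s + min s (P.edgeLength i - s)),
      P.critFun ((x' : AddCircle P.perimeter), (t : AddCircle P.puppyPeriod)) =
        inner ℝ (P.track (x' : AddCircle P.perimeter) - P.vertices i) (P.edgeDir i) -
          (t - P.puppyStart i) := by
    intro t ht
    have h1 := ht.1
    have h2 := ht.2
    have h3 := min_le_left s (P.edgeLength i - s)
    have h4 := min_le_right s (P.edgeLength i - s)
    have e : t = P.puppyStart i + (t - P.puppyStart i) := by ring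
    rw [critFun]
    simp only
    nth_rw 1 2 [e]
    rw [puppyPos_edge (by linarith) (by linarith), puppyDir_edge (by linarith) (by linarith),
      ← sub_sub, inner_sub_left, inner_ofReal_mul_left, inner_edgeDir_self, mul_one]
  intro t ht t' ht' htt
  have htt := (key t ht).symm.trans (htt.trans (key t' ht'))
  linarith

/-- Away from the diagonal, the attraction diagram is a curve, seen from a turning puppy. -/
theorem hasArcAt_of_turn {x : AddCircle P.perimeter} {i : Fin n} {s : ℝ} (h0 : 0 < s)
    (hs : s < |P.turn i|) (hne : P.track x ≠ P.vertices (i + 1))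
    (hz : P.critFun (x, ((P.puppyStart i + (P.edgeLength i + s) : ℝ) :
      AddCircle P.puppyPeriod)) = 0) :
    HasArcAt P.attractionDiagram
      (x, ((P.puppyStart i + (P.edgeLength i + s) : ℝ) : AddCircle P.puppyPeriod)) := by
  obtain ⟨x, rfl⟩ := QuotientAddGroup.mk_surjective x
  set σ : ℝ := (SignType.sign (P.turn i) : ℝ) with hσ
  have hσ2 : σ * σ = 1 := by
    have : P.turn i ≠ 0 := abs_pos.1 (h0.trans hs)
    rcases lt_or_gt_of_ne this with h | h <;> simp [hσ, h]
  set w : ℝ → ℂ := fun x' => P.track (x' : AddCircle P.perimeter) - P.vertices (i + 1)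
  have hw : Continuous w :=
    (P.continuous_track.comp (AddCircle.continuous_mk' _)).sub continuous_const
  set a : ℝ → ℝ := fun x' => inner ℝ (w x') (P.edgeDir i)
  set b : ℝ → ℝ := fun x' => inner ℝ (w x') (Complex.I * P.edgeDir i)
  have ha : Continuous a := hw.inner continuous_const
  have hb : Continuous b := hw.inner continuous_const
  have hwt : ∀ x' r, inner ℝ (w x') (P.turnDir i r) =
      Real.cos (σ * r) * a x' + Real.sin (σ * r) * b x' := by
    intro x' r
    rw [turnDir_eq, inner_add_right, real_inner_smul_right, real_inner_smul_right]
  -- Up to the sign `σ`, the derivative of the critical function in the turning time. It cannot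
  -- vanish together with that function, since the two are the coordinates of a nonzero vector in a
  -- rotated frame.
  set D : ℝ × ℝ → ℝ := fun z => Real.cos (σ * z.2) * b z.1 - Real.sin (σ * z.2) * a z.1
  have hD : Continuous D := by
    have h1 : Continuous fun z : ℝ × ℝ => a z.1 := ha.comp continuous_fst
    have h2 : Continuous fun z : ℝ × ℝ => b z.1 := hb.comp continuous_fst
    fun_prop
  have hab : a x ^ 2 + b x ^ 2 ≠ 0 := by
    have h1 : a x ^ 2 + b x ^ 2 = ‖w x‖ ^ 2 * ‖P.edgeDir i‖ ^ 2 := by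
      simp only [a, b, Complex.inner, ← Complex.normSq_eq_norm_sq, Complex.normSq_apply,
        Complex.mul_re, Complex.mul_im, Complex.conj_re, Complex.conj_im, Complex.I_re,
        Complex.I_im]
      ring
    rw [h1, norm_edgeDir, one_pow, mul_one]
    exact pow_ne_zero 2 (norm_ne_zero_iff.2 (sub_ne_zero.2 hne))
  have hz' : Real.cos (σ * s) * a x + Real.sin (σ * s) * b x = 0 := by
    rw [← hwt]
    rw [critFun] at hz
    simp only at hz
    rwa [puppyPos_turn h0.le hs.le, puppyDir_turn h0.le hs.le] at hz
  have hD0 : D (x, s) ≠ 0 := by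
    intro h
    apply hab
    simp only [D] at h
    have h1 := Real.sin_sq_add_cos_sq (σ * s)
    linear_combination (Real.cos (σ * s) * a x + Real.sin (σ * s) * b x) * hz' +
      (Real.cos (σ * s) * b x - Real.sin (σ * s) * a x) * h - (a x ^ 2 + b x ^ 2) * h1
  obtain ⟨ε, hε, hball⟩ := Metric.eventually_nhds_iff_ball.1 (hD.continuousAt.eventually_ne hD0)
  -- The bound 1 keeps half of any difference of turning times below π, so that its sine vanishes
  -- only at 0.
  set ε' := min (min ε 1) (min s (|P.turn i| - s))
  have hε' : 0 < ε' := lt_min (lt_min hε one_pos) (lt_min h0 (sub_pos.2 hs))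
  have hε1 : ε' ≤ ε := (min_le_left _ _).trans (min_le_left _ _)
  have hε2 : ε' ≤ 1 := (min_le_left _ _).trans (min_le_right _ _)
  have hε3 : ε' ≤ s := (min_le_right _ _).trans (min_le_left _ _)
  have hε4 : ε' ≤ |P.turn i| - s := (min_le_right _ _).trans (min_le_right _ _)
  refine hasArcAt_of_injOn P.continuous_critFun (x₀ := x) hε' (fun x' hx' => ?_) hz
  set Y := P.puppyStart i + P.edgeLength i with hY
  have hYs : P.puppyStart i + (P.edgeLength i + s) = Y + s := by rw [hY]; ring
  have key : ∀ t ∈ Ioo (P.puppyStart i + (P.edgeLength i + s) - ε')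
      (P.puppyStart i + (P.edgeLength i + s) + ε'),
      P.critFun ((x' : AddCircle P.perimeter), (t : AddCircle P.puppyPeriod)) =
        Real.cos (σ * (t - Y)) * a x' + Real.sin (σ * (t - Y)) * b x' := by
    intro t ht
    rw [hYs] at ht
    have h1 := ht.1
    have h2 := ht.2
    have e : t = P.puppyStart i + (P.edgeLength i + (t - Y)) := by rw [hY]; ring
    rw [critFun, ← hwt]
    simp only
    nth_rw 1 2 [e]
    rw [puppyPos_turn (by linarith) (by linarith), puppyDir_turn (by linarith) (by linarith)]
  intro t ht t' ht' htt
  have htt := (key t ht).symm.trans (htt.trans (key t' ht'))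
  rw [hYs] at ht ht'
  by_contra hne'
  -- half-angle formulas
  set m := (t - Y + (t' - Y)) / 2
  set d := (t - t') / 2
  have e1 : σ * (t - Y) = σ * m + σ * d := by simp only [m, d]; ring
  have e2 : σ * (t' - Y) = σ * m - σ * d := by simp only [m, d]; ring
  rw [e1, e2, Real.cos_add, Real.sin_add, Real.cos_sub, Real.sin_sub] at htt
  -- The difference of the two values is 2 sin(σd)·D at the midpoint.
  have h1 : Real.sin (σ * d) * D (x', m) = 0 := by
    simp only [D]
    linear_combination htt / 2
  have h2 : D (x', m) ≠ 0 := by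
    apply hball
    rw [Metric.mem_ball, Prod.dist_eq, max_lt_iff, Real.dist_eq, Real.dist_eq, abs_lt, abs_lt]
    simp only [m]
    refine ⟨⟨?_, ?_⟩, ?_, ?_⟩ <;> linarith [hx'.1, hx'.2, ht.1, ht.2, ht'.1, ht'.2]
  have h3 : Real.sin (σ * d) ≠ 0 := by
    have hd : |d| < 1 := by
      rw [abs_lt]
      simp only [d]
      constructor <;> linarith [ht.1, ht.2, ht'.1, ht'.2]
    have hσd : |σ * d| < 1 := (abs_sign_mul_le _ _).trans_lt hd
    have hpi := Real.pi_gt_three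
    have hd0 : σ * d ≠ 0 := by
      refine mul_ne_zero (fun h => ?_) (div_ne_zero (sub_ne_zero.2 hne') two_ne_zero)
      rw [h] at hσ2
      norm_num at hσ2
    rw [abs_lt] at hσd
    intro h
    exact hd0 ((Real.sin_eq_zero_iff_of_lt_of_lt (by linarith) (by linarith)).1 h)
  exact (mul_ne_zero h3 h2) h1

/-- Away from the diagonal, the attraction diagram is a curve, seen from a human in the interior
of an edge that is not orthogonal to the direction of the puppy. -/
theorem hasArcAt_of_human {i : Fin n} {s : ℝ} (h0 : 0 < s) (hs : s < P.edgeLength i)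
    {y : AddCircle P.puppyPeriod} (hne : inner ℝ (P.edgeDir i) (P.puppyDir y) ≠ 0)
    (hz : P.critFun (((P.humanStart i + s : ℝ) : AddCircle P.perimeter), y) = 0) :
    HasArcAt P.attractionDiagram (((P.humanStart i + s : ℝ) : AddCircle P.perimeter), y) := by
  obtain ⟨y, rfl⟩ := QuotientAddGroup.mk_surjective y
  have hc : Continuous fun t : ℝ =>
      inner ℝ (P.edgeDir i) (P.puppyDir (t : AddCircle P.puppyPeriod)) :=
    continuous_const.inner (P.continuous_puppyDir.comp (AddCircle.continuous_mk' _))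
  obtain ⟨ε, hε, hball⟩ := Metric.eventually_nhds_iff_ball.1
    (hc.continuousAt (x := y) |>.eventually_ne hne)
  rw [Real.ball_eq_Ioo] at hball
  set ε' := min ε (min s (P.edgeLength i - s))
  have hε' : 0 < ε' := lt_min hε (lt_min h0 (sub_pos.2 hs))
  have hε1 : ε' ≤ ε := min_le_left _ _
  have hε3 : ε' ≤ s := (min_le_right _ _).trans (min_le_left _ _)
  have hε4 : ε' ≤ P.edgeLength i - s := (min_le_right _ _).trans (min_le_right _ _)
  refine hasArcAt_of_injOn_left P.continuous_critFun (y₀ := y) hε' (fun t ht => ?_) hz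
  have hslope := hball t ⟨by linarith [ht.1], by linarith [ht.2]⟩
  have key : ∀ r ∈ Ioo (P.humanStart i + s - ε') (P.humanStart i + s + ε'),
      P.critFun ((r : AddCircle P.perimeter), (t : AddCircle P.puppyPeriod)) =
        inner ℝ (P.vertices i - P.puppyPos (t : AddCircle P.puppyPeriod))
          (P.puppyDir (t : AddCircle P.puppyPeriod)) + (r - P.humanStart i) *
            inner ℝ (P.edgeDir i) (P.puppyDir (t : AddCircle P.puppyPeriod)) := by
    intro r hr
    have h1 := hr.1
    have h2 := hr.2
    have e : r = P.humanStart i + (r - P.humanStart i) := by ring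
    rw [critFun]
    simp only
    nth_rw 1 [e]
    rw [track_apply (by linarith) (by linarith), add_sub_right_comm, inner_add_left,
      inner_ofReal_mul_left]
  intro r hr r' hr' hrr
  have hrr := (key r hr).symm.trans (hrr.trans (key r' hr'))
  have := mul_right_cancel₀ hslope (add_left_cancel hrr)
  linarith

/-- The critical function is affine along the human's edge and nonzero at every vertex except `k`.
So the human is not at a vertex, and slope zero would make both ends of the edge zeros, hence both
equal to vertex `k`. -/
theorem hasArcAt_of_vertex {k : Fin n} {x : AddCircle P.perimeter} {y : AddCircle P.puppyPeriod}
    (hy : P.puppyPos y = P.vertices k)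
    (hR : ∀ m, m ≠ k → inner ℝ (P.vertices m - P.vertices k) (P.puppyDir y) ≠ 0)
    (hne : P.track x ≠ P.vertices k) (hz : P.critFun (x, y) = 0) :
    HasArcAt P.attractionDiagram (x, y) := by
  obtain ⟨i, s, h0, hs, rfl⟩ := P.exists_human x
  rw [track_apply h0 hs.le] at hne
  have hz' : inner ℝ (P.vertices i - P.vertices k) (P.puppyDir y) +
      s * inner ℝ (P.edgeDir i) (P.puppyDir y) = 0 := by
    rw [critFun] at hz
    simp only at hz
    rwa [track_apply h0 hs.le, hy, add_sub_right_comm, inner_add_left, inner_ofReal_mul_left] at hz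
  rcases eq_or_lt_of_le h0 with rfl | h0
  · exfalso
    have hik : i ≠ k := by
      rintro rfl
      simp at hne
    exact hR i hik (by simpa using hz')
  · refine hasArcAt_of_human h0 hs (fun h => ?_) hz
    rw [h, mul_zero, add_zero] at hz'
    have h1 : i = k := by
      by_contra hik
      exact hR i hik hz'
    have h2 : i + 1 = k := by
      by_contra hik
      apply hR (i + 1) hik
      rw [← vertices_add_edge, add_sub_right_comm, inner_add_left, inner_ofReal_mul_left, h, hz']
      simp
    exact P.add_one_ne_self i (h2.trans h1.symm)

/-- Away from the diagonal, the attraction diagram is a curve. -/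
theorem hasArcAt (hright : P.NoRightAngle) {c : P.Torus} (hc : c ∈ P.attractionDiagram)
    (hd : c.1 ≠ P.collapse c.2) : HasArcAt P.attractionDiagram c := by
  obtain ⟨x, y⟩ := c
  have hne : P.track x ≠ P.puppyPos y := fun h => hd ((P.track_eq_puppyPos_iff (x, y)).1 h)
  have hz : P.critFun (x, y) = 0 := hc
  obtain ⟨i, ⟨s, h0, hs, rfl⟩ | ⟨s, h0, hs, rfl⟩⟩ := P.exists_puppy y
  · have hpos := puppyPos_edge h0 hs
    have hdir := puppyDir_edge h0 hs
    -- Where walking and turning meet, the critical function may fold in the puppy's parameter, so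
    -- the arc is parametrized by the puppy and not by the human.
    rcases eq_or_lt_of_le h0 with rfl | h0'
    · have hpos : _ = P.vertices i := hpos.trans (by simp)
      refine hasArcAt_of_vertex hpos (fun m hm => ?_) (hpos ▸ hne) hz
      rw [hdir]
      exact inner_vertices_sub_edgeVec_ne_zero hright hm
    rcases eq_or_lt_of_le hs with rfl | hs'
    · rw [vertices_add_edge] at hpos
      refine hasArcAt_of_vertex hpos (fun m hm => ?_) (hpos ▸ hne) hz
      rw [hdir]
      exact inner_vertices_sub_edgeVec_ne_zero' hright hm
    · exact hasArcAt_of_edge h0' hs' hz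
  · have hpos := puppyPos_turn h0 hs
    have hdir := puppyDir_turn h0 hs
    rcases eq_or_lt_of_le h0 with rfl | h0'
    · refine hasArcAt_of_vertex hpos (fun m hm => ?_) (hpos ▸ hne) hz
      rw [hdir, turnDir_zero]
      exact inner_vertices_sub_edgeVec_ne_zero' hright hm
    rcases eq_or_lt_of_le hs with rfl | hs'
    · refine hasArcAt_of_vertex hpos (fun m hm => ?_) (hpos ▸ hne) hz
      rw [hdir, turnDir_abs_turn]
      exact inner_vertices_sub_edgeVec_ne_zero hright hm
    · exact hasArcAt_of_turn h0' hs' (hpos ▸ hne) hz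

end SimplePolygon

end

/-! ### The diagonal, the other critical cycles, and the criterion for being essential. -/

section

open Topology Filter Set

theorem AddCircle.exists_abs_eq_norm {T : ℝ} (x : AddCircle T) :
    ∃ u : ℝ, (u : AddCircle T) = x ∧ |u| = ‖x‖ := by
  obtain ⟨r, rfl⟩ := QuotientAddGroup.mk_surjective x
  refine ⟨r - round (T⁻¹ * r) * T, ?_, (AddCircle.norm_eq T).symm⟩
  rw [AddCircle.coe_sub, ← zsmul_eq_mul, AddCircle.coe_zsmul, AddCircle.coe_period, zsmul_zero,
    sub_zero]

namespace SimplePolygon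

variable {n : ℕ} [NeZero n] (P : SimplePolygon n)

/-- The diagonal: the configurations at which the puppy has reached the human. -/
def diagonal : Set P.Torus := {c | c.1 = P.collapse c.2}

theorem continuous_prodMk_collapse :
    Continuous fun y : AddCircle P.puppyPeriod => ((P.collapse y, y) : P.Torus) :=
  P.continuous_collapse.prodMk continuous_id

theorem range_prodMk_collapse : range (fun y => ((P.collapse y, y) : P.Torus)) = P.diagonal := by
  ext ⟨x, y⟩
  constructor
  · rintro ⟨y', h⟩
    obtain ⟨rfl, rfl⟩ := Prod.ext_iff.1 h
    rfl
  · intro h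
    exact ⟨y, Prod.ext (Eq.symm h) rfl⟩

theorem diagonal_subset : P.diagonal ⊆ P.attractionDiagram := by
  intro c hc
  have := (P.track_eq_puppyPos_iff c).2 hc
  change inner ℝ (P.track c.1 - P.puppyPos c.2) (P.puppyDir c.2) = 0
  rw [this, sub_self, inner_zero_left]

theorem isSimpleClosedCurve_diagonal : IsSimpleClosedCurve P.diagonal := by
  let e := (AddCircle.homeomorphCircle P.puppyPeriod_pos.out.ne').symm
  refine ⟨⟨fun z => (P.collapse (e z), e z), P.continuous_prodMk_collapse.comp e.continuous⟩,
    fun z w h => e.injective (congrArg Prod.snd h), ?_⟩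
  rw [← range_prodMk_collapse]
  exact e.surjective.range_comp fun y => ((P.collapse y, y) : P.Torus)

/-- The puppy's parameter maps the diagonal homeomorphically onto a circle, so a null-homotopy would
give the identity of that circle a logarithm. -/
theorem isEssentialCurve_diagonal : IsEssentialCurve P.diagonal := by
  refine ⟨P.isSimpleClosedCurve_diagonal, fun γ hinj hγ hnull => ?_⟩
  have h1 := hasLog_of_nullhomotopic hnull
    (f := fun c : P.Torus => (AddCircle.toCircle c.2 : ℂ))
    (continuous_subtype_val.comp (AddCircle.continuous_toCircle.comp continuous_snd))
    fun c => Circle.coe_ne_zero _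
  have hbij : Function.Bijective fun z => (γ z).2 := by
    constructor
    · intro z w h
      refine hinj (Prod.ext ?_ h)
      have hz : γ z ∈ P.diagonal := hγ ▸ mem_range_self z
      have hw : γ w ∈ P.diagonal := hγ ▸ mem_range_self w
      exact Eq.trans hz (Eq.trans (congrArg P.collapse h) (Eq.symm hw))
    · intro y
      have : ((P.collapse y, y) : P.Torus) ∈ range γ := hγ ▸ rfl
      obtain ⟨z, hz⟩ := this
      exact ⟨z, by simp only [hz]⟩
  have hcont : Continuous fun z => (γ z).2 := continuous_snd.comp γ.continuous
  let e := Continuous.homeoOfEquivCompactToT2 (f := Equiv.ofBijective _ hbij) hcont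
  refine not_hasLog_toCircle (T := P.puppyPeriod) ((h1.comp e.symm.continuous).congr fun y => ?_)
  have : (γ (e.symm y)).2 = y := e.apply_symm_apply y
  rw [this]

variable {P}

/-- The strict signs just ahead of and just behind the puppy leave a gap around the diagonal. -/
theorem le_norm_sub_collapse (hlt : ∀ i, |P.turn i| < Real.pi / 2) {δ : ℝ}
    (hδ : ∀ i, δ ≤ P.edgeLength i) {c : P.Torus} (hc : c ∈ P.attractionDiagram)
    (hd : c ∉ P.diagonal) : δ ≤ ‖c.1 - P.collapse c.2‖ := by
  obtain ⟨u, hu, hun⟩ := AddCircle.exists_abs_eq_norm (c.1 - P.collapse c.2)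
  rw [← hun]
  by_contra! h
  rw [abs_lt] at h
  have hc' : P.critFun c = 0 := hc
  rcases lt_trichotomy u 0 with h0 | h0 | h0
  · have := critFun_behind hlt (neg_pos.2 h0) (fun i => by linarith [hδ i]) c.2
    rw [AddCircle.coe_neg, sub_neg_eq_add, hu, add_sub_cancel] at this
    exact this.ne hc'
  · rw [h0, AddCircle.coe_zero] at hu
    exact hd (sub_eq_zero.1 hu.symm)
  · have := critFun_ahead hlt h0 (fun i => by linarith [hδ i]) c.2
    rw [hu, add_sub_cancel] at this
    exact this.ne' hc'

/-- On the diagram, the distance along the track is either 0 or at least `δ`, so the level `δ / 2`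
separates the connected diagonal from the rest. -/
theorem connectedComponentIn_of_mem_diagonal (hlt : ∀ i, |P.turn i| < Real.pi / 2) {c : P.Torus}
    (hc : c ∈ P.diagonal) : connectedComponentIn P.attractionDiagram c = P.diagonal := by
  obtain ⟨δ, hδ0, hδ⟩ := P.exists_le_edgeLength
  apply Subset.antisymm
  · have hcont : Continuous fun c : P.Torus => ‖c.1 - P.collapse c.2‖ :=
      (continuous_fst.sub (P.continuous_collapse.comp continuous_snd)).norm
    have h1 : connectedComponentIn P.attractionDiagram c ⊆
        {c : P.Torus | ‖c.1 - P.collapse c.2‖ < δ / 2} := by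
      refine isPreconnected_connectedComponentIn.subset_left_of_subset_union
        (isOpen_lt hcont continuous_const)
        (v := {c : P.Torus | δ / 2 < ‖c.1 - P.collapse c.2‖})
        (isOpen_lt continuous_const hcont) ?_ ?_ ?_
      · exact disjoint_left.2 fun z h h' => lt_asymm (mem_ofPred_eq ▸ h) h'
      · intro z hz
        by_cases hd : z ∈ P.diagonal
        · left
          have : z.1 - P.collapse z.2 = 0 := sub_eq_zero.2 hd
          rw [mem_ofPred_eq, this, norm_zero]
          exact half_pos hδ0
        · right
          exact (half_lt_self hδ0).trans_le
            (le_norm_sub_collapse hlt hδ (connectedComponentIn_subset _ _ hz) hd)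
      · refine ⟨c, mem_connectedComponentIn (P.diagonal_subset hc), ?_⟩
        have : c.1 - P.collapse c.2 = 0 := sub_eq_zero.2 hc
        rw [mem_ofPred_eq, this, norm_zero]
        exact half_pos hδ0
    intro z hz
    by_contra hd
    have h2 := le_norm_sub_collapse hlt hδ (connectedComponentIn_subset _ _ hz) hd
    have h3 := h1 hz
    rw [mem_ofPred_eq] at h3
    linarith
  · refine IsPreconnected.subset_connectedComponentIn ?_ hc P.diagonal_subset
    rw [← range_prodMk_collapse]
    exact isPreconnected_range P.continuous_prodMk_collapse

theorem isCriticalCycle_diagonal (hlt : ∀ i, |P.turn i| < Real.pi / 2) :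
    P.IsCriticalCycle P.diagonal := by
  have h : ((P.collapse 0, 0) : P.Torus) ∈ P.diagonal := rfl
  exact ⟨_, P.diagonal_subset h, (connectedComponentIn_of_mem_diagonal hlt h).symm⟩

variable (P) in
/-- A critical cycle other than the diagonal. -/
def IsOffDiagonalCycle (C : Set P.Torus) : Prop :=
  ∃ c ∈ P.attractionDiagram, c ∉ P.diagonal ∧ C = connectedComponentIn P.attractionDiagram c

namespace IsOffDiagonalCycle

variable {C C' : Set P.Torus}

theorem isCriticalCycle (h : P.IsOffDiagonalCycle C) : P.IsCriticalCycle C := by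
  obtain ⟨c, hc, -, rfl⟩ := h
  exact ⟨c, hc, rfl⟩

theorem nonempty (h : P.IsOffDiagonalCycle C) : C.Nonempty := by
  obtain ⟨c, hc, -, rfl⟩ := h
  exact ⟨c, mem_connectedComponentIn hc⟩

theorem isPreconnected (h : P.IsOffDiagonalCycle C) : IsPreconnected C := by
  obtain ⟨c, hc, -, rfl⟩ := h
  exact isPreconnected_connectedComponentIn

theorem isCompact (h : P.IsOffDiagonalCycle C) : IsCompact C := by
  obtain ⟨c, hc, -, rfl⟩ := h
  refine (isClosed_of_closure_subset ?_).isCompact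
  exact isPreconnected_connectedComponentIn.closure.subset_connectedComponentIn
    (subset_closure (mem_connectedComponentIn hc))
    (closure_minimal (connectedComponentIn_subset _ _) P.isClosed_attractionDiagram)

theorem subset (h : P.IsOffDiagonalCycle C) : C ⊆ P.attractionDiagram := by
  obtain ⟨c, hc, -, rfl⟩ := h
  exact connectedComponentIn_subset _ _

theorem notMem_diagonal (hlt : ∀ i, |P.turn i| < Real.pi / 2) (h : P.IsOffDiagonalCycle C)
    {z : P.Torus} (hz : z ∈ C) : z ∉ P.diagonal := by
  obtain ⟨c, hc, hd, rfl⟩ := h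
  intro hz'
  have h1 := connectedComponentIn_of_mem_diagonal hlt hz'
  rw [← connectedComponentIn_eq hz] at h1
  exact hd (h1 ▸ mem_connectedComponentIn hc)

theorem eq_of_mem (h : P.IsOffDiagonalCycle C) {z : P.Torus} (hz : z ∈ C) :
    C = connectedComponentIn P.attractionDiagram z := by
  obtain ⟨c, hc, hd, rfl⟩ := h
  exact connectedComponentIn_eq hz

theorem hasArcAt (hlt : ∀ i, |P.turn i| < Real.pi / 2) (hright : P.NoRightAngle)
    (h : P.IsOffDiagonalCycle C) {z : P.Torus} (hz : z ∈ C) : HasArcAt P.attractionDiagram z :=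
  SimplePolygon.hasArcAt hright (h.subset hz) (h.notMem_diagonal hlt hz)

theorem isSimpleClosedCurve (hlt : ∀ i, |P.turn i| < Real.pi / 2) (hright : P.NoRightAngle)
    (h : P.IsOffDiagonalCycle C) : IsSimpleClosedCurve C := by
  have hcomp := isCompact_iff_compactSpace.1 h.isCompact
  have hconn : ConnectedSpace C :=
    isConnected_iff_connectedSpace.1 ⟨h.nonempty, h.isPreconnected⟩
  have hloc : LocallyArc C := by
    obtain ⟨c, hc, hd, rfl⟩ := id h
    exact locallyArc_of_hasArcAt fun z hz => h.hasArcAt hlt hright hz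
  obtain ⟨γ, hinj, hsurj⟩ := hloc.exists_circle
  refine ⟨⟨fun z => (γ z : P.Torus), continuous_subtype_val.comp γ.continuous⟩,
    Subtype.val_injective.comp hinj, ?_⟩
  change range (Subtype.val ∘ γ) = C
  rw [hsurj.range_comp, Subtype.range_coe]

/-- Cycles are relatively open in the diagram, so functions given cycle by cycle are continuous
without any count of the cycles. -/
theorem exists_isOpen (hlt : ∀ i, |P.turn i| < Real.pi / 2) (hright : P.NoRightAngle)
    (h : P.IsOffDiagonalCycle C) {z : P.Torus} (hz : z ∈ C) :
    ∃ O, IsOpen O ∧ z ∈ O ∧ P.attractionDiagram ∩ O ⊆ C := by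
  obtain ⟨ψ, hc, hi, h0, ho⟩ := h.hasArcAt hlt hright hz
  obtain ⟨O, hO, hψ⟩ := ho univ isOpen_univ
  rw [image_univ] at hψ
  have hz' : z ∈ P.attractionDiagram ∩ O := hψ ▸ ⟨0, h0⟩
  refine ⟨O, hO, hz'.2, ?_⟩
  rw [h.eq_of_mem hz, ← hψ]
  exact (isPreconnected_range hc).subset_connectedComponentIn ⟨0, h0⟩
    (hψ ▸ inter_subset_left)

end IsOffDiagonalCycle

theorem IsCriticalCycle.eq_diagonal_or (hlt : ∀ i, |P.turn i| < Real.pi / 2) {C : Set P.Torus}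
    (h : P.IsCriticalCycle C) : C = P.diagonal ∨ P.IsOffDiagonalCycle C := by
  obtain ⟨c, hc, rfl⟩ := h
  by_cases hd : c ∈ P.diagonal
  · exact .inl (connectedComponentIn_of_mem_diagonal hlt hd)
  · exact .inr ⟨c, hc, hd, rfl⟩

variable (P) in
-- The collapse has degree one: both phases gain 2π over a period, so their difference is a real
-- periodic function.
theorem hasLog_collapse_div : HasLog fun y : AddCircle P.puppyPeriod =>
    (AddCircle.toCircle (P.collapse y) : ℂ) / (AddCircle.toCircle y : ℂ) := by
  have hL := P.perimeter_pos.out.ne'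
  have hM := P.puppyPeriod_pos.out.ne'
  let f : ℝ → ℝ := fun t => 2 * Real.pi / P.perimeter * P.collapseFun t -
    2 * Real.pi / P.puppyPeriod * t
  have hf : Continuous f := by
    have := P.continuous_collapseFun
    fun_prop
  have hf0 : f 0 = f P.puppyPeriod := by
    simp only [f, collapseFun_zero, collapseFun_puppyPeriod]
    field_simp
    ring
  have hcont : Continuous (AddCircle.liftIco P.puppyPeriod 0 f) :=
    AddCircle.liftIco_zero_continuous hf0 hf.continuousOn
  refine ⟨fun y => ((AddCircle.liftIco P.puppyPeriod 0 f y : ℝ) : ℂ) * Complex.I, by fun_prop,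
    fun y => ?_⟩
  beta_reduce
  obtain ⟨t, ht, rfl⟩ := AddCircle.eq_coe_Ico y
  rw [AddCircle.liftIco_zero_coe_apply ht, P.collapse_coe ⟨ht.1, ht.2.le⟩,
    AddCircle.toCircle_apply_mk, AddCircle.toCircle_apply_mk, Circle.coe_exp, Circle.coe_exp,
    ← Complex.exp_sub, ← sub_mul, ← Complex.ofReal_sub]

/-- Off the diagonal `x` minus the collapse of `y` omits 0 and thus has a logarithm. Since the
collapse has degree one, `x` and `y` wind together. -/
theorem hasLog_fst_iff {K : Type*} [TopologicalSpace K] {f : K → P.Torus} (hf : Continuous f)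
    (hd : ∀ k, f k ∉ P.diagonal) :
    (HasLog fun k => (AddCircle.toCircle (f k).1 : ℂ)) ↔
      HasLog fun k => (AddCircle.toCircle (f k).2 : ℂ) := by
  have h1 : HasLog fun k =>
      (AddCircle.toCircle ((f k).1 - P.collapse (f k).2) : ℂ) := by
    refine hasLog_toCircle_of_ne (a := 0) ?_ fun k h => hd k (sub_eq_zero.1 h)
    exact (continuous_fst.comp hf).sub (P.continuous_collapse.comp (continuous_snd.comp hf))
  have h2 := h1.mul (P.hasLog_collapse_div.comp (continuous_snd.comp hf))
  have h3 : HasLog fun k =>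
      (AddCircle.toCircle (f k).1 : ℂ) / (AddCircle.toCircle (f k).2 : ℂ) :=
    h2.congr fun k => by
      rw [Function.comp_apply, ← mul_div_assoc, ← Circle.coe_mul, ← AddCircle.toCircle_add,
        sub_add_cancel]
  constructor
  · intro h
    refine (h.div h3).congr fun k => ?_
    field_simp [Circle.coe_ne_zero]
  · intro h
    refine (h3.mul h).congr fun k => ?_
    field_simp [Circle.coe_ne_zero]

/-- A simple closed curve off the diagonal is essential if and only if the position of the puppy
winds around its circle. -/
theorem isEssentialCurve_iff {C : Set P.Torus} (hC : IsSimpleClosedCurve C)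
    (hd : ∀ c ∈ C, c ∉ P.diagonal) :
    IsEssentialCurve C ↔ ¬ HasLog fun c : C => (AddCircle.toCircle c.1.2 : ℂ) := by
  constructor
  · rintro ⟨⟨γ, hinj, rfl⟩, hess⟩ hlog
    apply hess γ hinj rfl
    have h2 : HasLog fun z => (AddCircle.toCircle (γ z).2 : ℂ) :=
      hlog.comp (u := fun z => (⟨γ z, mem_range_self z⟩ : range γ)) (γ.continuous.subtype_mk _)
    exact nullhomotopic_of_hasLog
      ((hasLog_fst_iff γ.continuous fun z => hd _ (mem_range_self z)).2 h2) h2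
  · refine fun hlog => ⟨hC, fun γ hinj hγ hnull => hlog ?_⟩
    subst hγ
    have h1 := hasLog_of_nullhomotopic hnull
      (f := fun c : P.Torus => (AddCircle.toCircle c.2 : ℂ))
      (continuous_subtype_val.comp (AddCircle.continuous_toCircle.comp continuous_snd))
      fun c => Circle.coe_ne_zero _
    let e := Continuous.homeoOfEquivCompactToT2 (f := Equiv.ofInjective γ hinj)
      (γ.continuous.subtype_mk _)
    refine (h1.comp e.symm.continuous).congr fun c => ?_
    have : γ (e.symm c) = c.1 := congrArg Subtype.val (e.apply_symm_apply c)
    rw [this]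

end SimplePolygon

end

/-! ### Existence of a second essential cycle. -/

section

open Topology Filter Set

theorem HasLog.exists_continuousOn {X : Type*} [TopologicalSpace X] {C : Set X} {f : X → ℂ}
    (h : HasLog fun c : C => f c) :
    ∃ g : X → ℂ, ContinuousOn g C ∧ ∀ c ∈ C, Complex.exp (g c) = f c := by
  classical
  obtain ⟨g, hg, hg'⟩ := h
  refine ⟨fun c => if hc : c ∈ C then g ⟨c, hc⟩ else 0, ?_, fun c hc => ?_⟩
  · rw [continuousOn_iff_continuous_domRestrict]
    refine hg.congr fun c => ?_
    simp
  · simp only [hc, dite_true]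
    exact hg' ⟨c, hc⟩

namespace SimplePolygon

variable {n : ℕ} [NeZero n] {P : SimplePolygon n}

/-- If the puppy does not wind around along any critical cycle other than the diagonal, then its
position has a logarithm on all of the attraction diagram but the diagonal. -/
theorem exists_continuousOn_diff_diagonal (hlt : ∀ i, |P.turn i| < Real.pi / 2)
    (hright : P.NoRightAngle)
    (hlog : ∀ C, P.IsOffDiagonalCycle C →
      HasLog fun c : C => (AddCircle.toCircle c.1.2 : ℂ)) :
    ∃ g : P.Torus → ℂ, ContinuousOn g (P.attractionDiagram \ P.diagonal) ∧
      ∀ c ∈ P.attractionDiagram \ P.diagonal, Complex.exp (g c) = AddCircle.toCircle c.2 := by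
  choose! G hG hG' using fun C h => HasLog.exists_continuousOn
    (f := fun c : P.Torus => (AddCircle.toCircle c.2 : ℂ)) (hlog C h)
  have hcyc : ∀ c ∈ P.attractionDiagram \ P.diagonal,
      P.IsOffDiagonalCycle (connectedComponentIn P.attractionDiagram c) :=
    fun c hc => ⟨c, hc.1, hc.2, rfl⟩
  refine ⟨fun c => G (connectedComponentIn P.attractionDiagram c) c, fun c hc => ?_,
    fun c hc => hG' _ (hcyc c hc) c (mem_connectedComponentIn hc.1)⟩
  have hC := hcyc c hc
  have hcC := mem_connectedComponentIn hc.1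
  obtain ⟨O, hO, hcO, hsub⟩ := hC.exists_isOpen hlt hright hcC
  have h1 : ContinuousWithinAt (G (connectedComponentIn P.attractionDiagram c))
      ((P.attractionDiagram \ P.diagonal) ∩ O) c :=
    ((hG _ hC) c hcC).mono fun z hz => hsub ⟨hz.1.1, hz.2⟩
  rw [continuousWithinAt_inter (hO.mem_nhds hcO)] at h1
  refine h1.congr_of_eventuallyEq ?_ rfl
  filter_upwards [inter_mem self_mem_nhdsWithin (mem_nhdsWithin_of_mem_nhds (hO.mem_nhds hcO))]
    with z hz
  rw [← hC.eq_of_mem (hsub ⟨hz.1.1, hz.2⟩)]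

/-- The zero set must separate the side of the diagonal where the human is ahead from the side where
she is behind; if the puppy wound along no cycle, the zero set could not do so. -/
theorem exists_isOffDiagonalCycle_not_hasLog (hlt : ∀ i, |P.turn i| < Real.pi / 2)
    (hright : P.NoRightAngle) : ∃ C, P.IsOffDiagonalCycle C ∧
      ¬ HasLog fun c : C => (AddCircle.toCircle c.1.2 : ℂ) := by
  by_contra! hlog
  obtain ⟨g, hg, hg'⟩ := exists_continuousOn_diff_diagonal hlt hright hlog
  obtain ⟨δ₀, hδ₀, hδ⟩ := P.exists_le_edgeLength
  have hL := P.perimeter_pos.out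
  set δ := min δ₀ (P.perimeter / 2)
  have hδ0 : 0 < δ := lt_min hδ₀ (half_pos hL)
  have hδ1 : ∀ i, δ ≤ P.edgeLength i := fun i => (min_le_left _ _).trans (hδ i)
  have hδ2 : δ ≤ P.perimeter / 2 := min_le_right _ _
  -- The human's lead over the puppy along the track. Its ends mean `δ` ahead and `δ` behind, and
  -- `Φ` identifies `B` times the puppy's circle with the annulus off the diagonal.
  let B := Icc δ (P.perimeter - δ)
  have hB : PreconnectedSpace B := isPreconnected_iff_preconnectedSpace.1 isPreconnected_Icc
  let Φ : B × AddCircle P.puppyPeriod → P.Torus :=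
    fun z => (P.collapse z.2 + ((z.1 : ℝ) : AddCircle P.perimeter), z.2)
  have hΦ : Continuous Φ :=
    ((P.continuous_collapse.comp continuous_snd).add ((AddCircle.continuous_mk' _).comp
      (continuous_subtype_val.comp continuous_fst))).prodMk continuous_snd
  have hΦd : ∀ z, Φ z ∉ P.diagonal := by
    intro z hz
    have h1 : (((z.1 : ℝ)) : AddCircle P.perimeter) = 0 := add_eq_left.1 hz
    have h2 := z.1.2.1
    have h3 := z.1.2.2
    rw [← AddCircle.coe_zero, AddCircle.coe_eq_coe_iff_of_mem_Ico (a := 0)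
      ⟨by linarith, by linarith⟩ ⟨le_rfl, by linarith⟩] at h1
    linarith
  let A := Φ ⁻¹' P.attractionDiagram
  have hA : IsClosed A := P.isClosed_attractionDiagram.preimage hΦ
  have hgA : Continuous fun z : A => g (Φ z) :=
    hg.comp_continuous (hΦ.comp continuous_subtype_val) fun z => ⟨z.2, hΦd z⟩
  -- Tietze extension of the logarithm from the zero set to the annulus.
  obtain ⟨gt, hgt⟩ := ContinuousMap.exists_restrict_eq hA ⟨_, hgA⟩
  have hgt' : ∀ z ∈ A, Complex.exp (gt z) = AddCircle.toCircle z.2 := by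
    intro z hz
    have h1 : gt z = g (Φ z) := congrArg (fun f : C(A, ℂ) => f ⟨z, hz⟩) hgt
    rw [h1]
    exact hg' _ ⟨hz, hΦd z⟩
  -- The two pieces agree on the zero set. At lead `δ` only the piece with a logarithm is seen, at
  -- the other end only the identity of the circle.
  let H : B × AddCircle P.puppyPeriod → ℂ :=
    fun z => if 0 ≤ P.critFun (Φ z) then Complex.exp (gt z) else (AddCircle.toCircle z.2 : ℂ)
  have hH : Continuous H := by
    refine Continuous.if_le (Complex.continuous_exp.comp gt.continuous)
      (continuous_subtype_val.comp (AddCircle.continuous_toCircle.comp continuous_snd))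
      continuous_const (P.continuous_critFun.comp hΦ) fun z hz => hgt' z ?_
    exact hz.symm
  have hH0 : ∀ z, H z ≠ 0 := by
    intro z
    simp only [H]
    split_ifs
    · exact Complex.exp_ne_zero _
    · exact Circle.coe_ne_zero _
  let a : B := ⟨δ, le_rfl, by linarith⟩
  let b : B := ⟨P.perimeter - δ, by linarith, le_rfl⟩
  have ha : HasLog fun y => H (a, y) := by
    refine ⟨fun y => gt (a, y), gt.continuous.comp (continuous_const.prodMk continuous_id),
      fun y => ?_⟩
    simp only [H]
    rw [if_pos (critFun_ahead hlt hδ0 hδ1 y).le]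
  have hb := HasLog.of_preconnected hH hH0 (b := b) ha
  refine not_hasLog_toCircle (T := P.puppyPeriod) (hb.congr fun y => ?_)
  have h1 : Φ (b, y) = (P.collapse y - (δ : AddCircle P.perimeter), y) := by
    simp only [Φ, b]
    rw [AddCircle.coe_sub, AddCircle.coe_period, zero_sub, sub_eq_add_neg]
  simp only [H]
  rw [h1, if_neg (not_le.2 (critFun_behind hlt hδ0 hδ1 y))]

end SimplePolygon

end

/-! ### Uniqueness of the second essential cycle. -/

section

open Topology Filter Set

/-- Leaving the slit plane requires `exp d * u` to be real and at least 1, which forces `u = 1` and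
`d ≥ 0`. -/
theorem one_sub_exp_mul_mem_slitPlane {d : ℝ} {u : Circle} (h : u = 1 → d < 0) :
    1 - (Real.exp d : ℂ) * u ∈ Complex.slitPlane := by
  by_contra hw
  rw [Complex.mem_slitPlane_iff] at hw
  push Not at hw
  obtain ⟨hre, him⟩ := hw
  rw [Complex.sub_re, Complex.re_ofReal_mul, Complex.one_re] at hre
  rw [Complex.sub_im, Complex.im_ofReal_mul, Complex.one_im, zero_sub, neg_eq_zero] at him
  have hpos := Real.exp_pos d
  have him' : (u : ℂ).im = 0 := (mul_eq_zero.1 him).resolve_left hpos.ne'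
  have hn := Circle.normSq_coe u
  rw [Complex.normSq_apply, him'] at hn
  have hre0 : 0 < (u : ℂ).re := by
    by_contra! h0
    nlinarith
  have hre1 : (u : ℂ).re = 1 := by nlinarith
  have hu : u = 1 := by
    ext
    exact Complex.ext (by simpa using hre1) (by simpa using him')
  have hd := Real.exp_lt_exp.2 (h hu)
  rw [Real.exp_zero] at hd
  rw [hre1] at hre
  linarith

/-- Along a line the squared norm is a quadratic polynomial with positive leading coefficient, hence
strictly convex. -/
theorem norm_add_smul_lt {E : Type*} [NormedAddCommGroup E] [InnerProductSpace ℝ E] {z v : E}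
    (hv : v ≠ 0) {s r t N : ℝ} (hsr : s < r) (hrt : r < t) (hs : ‖z + s • v‖ ≤ N)
    (ht : ‖z + t • v‖ ≤ N) : ‖z + r • v‖ < N := by
  have hN : 0 ≤ N := (norm_nonneg _).trans hs
  have hexp : ∀ a : ℝ, ‖z + a • v‖ ^ 2 = ‖z‖ ^ 2 + 2 * (a * inner ℝ z v) + a ^ 2 * ‖v‖ ^ 2 := by
    intro a
    rw [norm_add_sq_real, real_inner_smul_right, norm_smul, mul_pow, Real.norm_eq_abs, sq_abs]
  have hs2 := pow_le_pow_left₀ (norm_nonneg _) hs 2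
  have ht2 := pow_le_pow_left₀ (norm_nonneg _) ht 2
  rw [hexp] at hs2 ht2
  refine lt_of_pow_lt_pow_left₀ 2 hN ?_
  rw [hexp]
  have hv2 : 0 < ‖v‖ ^ 2 := pow_pos (norm_pos_iff.2 hv) 2
  have h1 := mul_le_mul_of_nonneg_left hs2 (sub_pos.2 hrt).le
  have h2 := mul_le_mul_of_nonneg_left ht2 (sub_pos.2 hsr).le
  have h3 := mul_pos (mul_pos (mul_pos (sub_pos.2 hsr) (sub_pos.2 hrt))
    (sub_pos.2 (hsr.trans hrt))) hv2
  refine lt_of_mul_lt_mul_left ?_ (sub_pos.2 (hsr.trans hrt)).le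
  linear_combination h1 + h2 + h3

namespace SimplePolygon

variable {n : ℕ} [NeZero n] (P : SimplePolygon n)

theorem norm_puppyDir (y : AddCircle P.puppyPeriod) : ‖P.puppyDir y‖ = 1 := by
  obtain ⟨i, ⟨s, h0, hs, rfl⟩ | ⟨s, h0, hs, rfl⟩⟩ := P.exists_puppy y
  · rw [puppyDir_edge h0 hs, norm_edgeDir]
  · rw [puppyDir_turn h0 hs, turnDir, norm_mul, norm_edgeDir, one_mul, mul_comm,
      Complex.norm_exp_ofReal_mul_I]

/-- The signed distance of the human to the left of the puppy. -/
noncomputable def offset (c : P.Torus) : ℝ :=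
  inner ℝ (P.track c.1 - P.puppyPos c.2) (Complex.I * P.puppyDir c.2)

theorem continuous_offset : Continuous P.offset :=
  ((P.continuous_track.comp continuous_fst).sub
    (P.continuous_puppyPos.comp continuous_snd)).inner
      (continuous_const.mul (P.continuous_puppyDir.comp continuous_snd))

variable {P}

theorem track_eq_of_mem {c : P.Torus} (hc : c ∈ P.attractionDiagram) :
    P.track c.1 = P.puppyPos c.2 + P.offset c • (Complex.I * P.puppyDir c.2) := by
  have h0 : inner ℝ (P.track c.1 - P.puppyPos c.2) (P.puppyDir c.2) = 0 := hc
  have h1 := Complex.normSq_eq_norm_sq (P.puppyDir c.2)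
  rw [norm_puppyDir, one_pow, Complex.normSq_apply] at h1
  rw [← sub_eq_iff_eq_add', offset]
  set z := P.track c.1 - P.puppyPos c.2
  set w := P.puppyDir c.2
  rw [Complex.inner] at h0 ⊢
  rw [Complex.real_smul]
  simp only [Complex.mul_re, Complex.mul_im, Complex.conj_re, Complex.conj_im, Complex.I_re,
    Complex.I_im] at h0 ⊢
  apply Complex.ext
  · simp only [Complex.mul_re, Complex.mul_im, Complex.I_re, Complex.I_im, Complex.ofReal_re,
      Complex.ofReal_im]
    linear_combination w.re * h0 - z.re * h1
  · simp only [Complex.mul_re, Complex.mul_im, Complex.I_re, Complex.I_im, Complex.ofReal_re,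
      Complex.ofReal_im]
    linear_combination w.im * h0 - z.im * h1

theorem offset_ne_zero {c : P.Torus} (hc : c ∈ P.attractionDiagram) (hd : c ∉ P.diagonal) :
    P.offset c ≠ 0 := by
  intro h
  have h1 := track_eq_of_mem hc
  rw [h, zero_smul, add_zero] at h1
  exact hd ((P.track_eq_puppyPos_iff c).1 h1)

/-- At a critical configuration the human is on the puppy's normal line, so the offset gives her
place, and the polygon is simple. -/
theorem eq_of_offset_eq {c c' : P.Torus} (hc : c ∈ P.attractionDiagram)
    (hc' : c' ∈ P.attractionDiagram) (hy : c.2 = c'.2) (h : P.offset c = P.offset c') : c = c' := by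
  refine Prod.ext (P.track_injective ?_) hy
  rw [track_eq_of_mem hc, track_eq_of_mem hc', hy, h]

/-- A point of the polygon that is farthest from the origin does not lie strictly between two
others. -/
theorem not_strictly_between {x : AddCircle P.perimeter}
    (hx : ∀ x', ‖P.track x'‖ ≤ ‖P.track x‖) {y : AddCircle P.puppyPeriod} {σ s r t : ℝ}
    (hσ : σ ≠ 0) (hsr : s < r) (hrt : r < t) {a b : AddCircle P.perimeter}
    (ha : P.track a = P.puppyPos y + s • (σ • (Complex.I * P.puppyDir y)))
    (hxr : P.track x = P.puppyPos y + r • (σ • (Complex.I * P.puppyDir y)))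
    (hb : P.track b = P.puppyPos y + t • (σ • (Complex.I * P.puppyDir y))) : False := by
  have hv : σ • (Complex.I * P.puppyDir y) ≠ 0 := by
    refine smul_ne_zero hσ (mul_ne_zero Complex.I_ne_zero ?_)
    rw [← norm_ne_zero_iff, norm_puppyDir]
    exact one_ne_zero
  have := norm_add_smul_lt (z := P.puppyPos y) hv hsr hrt (ha ▸ hx a) (hb ▸ hx b)
  rw [← hxr] at this
  exact this.false

variable (P) in
theorem exists_farthest : ∃ x, ∀ x', ‖P.track x'‖ ≤ ‖P.track x‖ := by
  obtain ⟨x, -, hx⟩ := isCompact_univ.exists_isMaxOn (univ_nonempty (α := AddCircle P.perimeter))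
    P.continuous_track.norm.continuousOn
  exact ⟨x, fun x' => hx (mem_univ x')⟩

variable (P) in
theorem collapse_surjective : Function.Surjective P.collapse := by
  intro x
  obtain ⟨i, s, h0, hs, rfl⟩ := P.exists_human x
  exact ⟨_, collapse_edge h0 hs.le⟩

namespace IsOffDiagonalCycle

variable {C C' : Set P.Torus}

/-- The offset vanishes only on the diagonal, so its sign is constant on a connected cycle. -/
theorem mul_offset_pos (hlt : ∀ i, |P.turn i| < Real.pi / 2) (h : P.IsOffDiagonalCycle C) {σ : ℝ}
    (hσ : σ ≠ 0) {c : P.Torus} (hc : c ∈ C) (hpos : 0 < σ * P.offset c) :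
    ∀ c' ∈ C, 0 < σ * P.offset c' := by
  intro c' hc'
  by_contra! hle
  obtain ⟨z, hz, hz0⟩ := h.isPreconnected.intermediate_value hc' hc
    (continuous_const.mul P.continuous_offset).continuousOn ⟨hle, hpos.le⟩
  exact mul_ne_zero hσ (offset_ne_zero (h.subset hz) (h.notMem_diagonal hlt hz)) hz0

theorem exists_fst_eq (hlt : ∀ i, |P.turn i| < Real.pi / 2) (h : P.IsOffDiagonalCycle C)
    (hlog : ¬ HasLog fun c : C => (AddCircle.toCircle c.1.2 : ℂ)) (x : AddCircle P.perimeter) :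
    ∃ c ∈ C, c.1 = x := by
  by_contra! hne
  refine hlog ((hasLog_fst_iff continuous_subtype_val fun c => h.notMem_diagonal hlt c.2).1 ?_)
  exact hasLog_toCircle_of_ne (continuous_fst.comp continuous_subtype_val) fun c : C => hne c c.2

theorem exists_snd_eq (hlog : ¬ HasLog fun c : C => (AddCircle.toCircle c.1.2 : ℂ))
    (y : AddCircle P.puppyPeriod) : ∃ c ∈ C, c.2 = y := by
  by_contra! hne
  exact hlog
    (hasLog_toCircle_of_ne (continuous_snd.comp continuous_subtype_val) fun c : C => hne c c.2)

theorem disjoint (h : P.IsOffDiagonalCycle C) (h' : P.IsOffDiagonalCycle C') (hne : C ≠ C') :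
    Disjoint C C' :=
  disjoint_left.2 fun _ hz hz' => hne ((h.eq_of_mem hz).trans (h'.eq_of_mem hz').symm)

/-- If the human stays on the same side of the puppy along two cycles around which the puppy
winds, then neither of them comes closest to the puppy. -/
theorem false_of_offset_le (hlt : ∀ i, |P.turn i| < Real.pi / 2) (h : P.IsOffDiagonalCycle C)
    (h' : P.IsOffDiagonalCycle C') (hne : C ≠ C')
    (hlog : ¬ HasLog fun c : C => (AddCircle.toCircle c.1.2 : ℂ))
    (hlog' : ¬ HasLog fun c : C' => (AddCircle.toCircle c.1.2 : ℂ)) {σ : ℝ} (hσ : σ ≠ 0)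
    (hpos : ∀ c ∈ C, 0 < σ⁻¹ * P.offset c) {c₀ : P.Torus}
    (hc₀ : c₀ ∈ C) (hmin : ∀ c' ∈ C', σ⁻¹ * P.offset c₀ ≤ σ⁻¹ * P.offset c') : False := by
  have hconn : PreconnectedSpace C := isPreconnected_iff_preconnectedSpace.1 h.isPreconnected
  have hcomp : CompactSpace C' := isCompact_iff_compactSpace.1 h'.isCompact
  obtain ⟨x, hx⟩ := P.exists_farthest
  obtain ⟨a, ha, rfl⟩ := h.exists_fst_eq hlt hlog x
  let d : C × C' → ℝ := fun z => σ⁻¹ * P.offset z.2 - σ⁻¹ * P.offset z.1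
  let u : C × C' → Circle := fun z => AddCircle.toCircle (z.2.1.2 - z.1.1.2)
  have hd : Continuous d := by
    have := P.continuous_offset
    fun_prop
  have hu : Continuous u := AddCircle.continuous_toCircle.comp (by fun_prop)
  have hu1 : ∀ z, u z = 1 → z.1.1.2 = z.2.1.2 := by
    intro z hz
    rw [← AddCircle.toCircle_zero (T := P.puppyPeriod)] at hz
    exact (sub_eq_zero.1
      (AddCircle.injective_toCircle P.puppyPeriod_pos.out.ne' hz)).symm
  have hd0 : ∀ z, u z = 1 → d z ≠ 0 := by
    intro z hz hz0
    have h1 := mul_left_cancel₀ (inv_ne_zero hσ) (sub_eq_zero.1 hz0)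
    have h2 := eq_of_offset_eq (h.subset z.1.2) (h'.subset z.2.2) (hu1 z hz) h1.symm
    exact disjoint_left.1 (h.disjoint h' hne) z.1.2 (h2 ▸ z.2.2)
  -- It vanishes only at equal puppy parameters and equal offsets, that is, at a common point of the
  -- two disjoint cycles.
  let f : C × C' → ℂ := fun z => 1 - (Real.exp (d z) : ℂ) * u z
  have huC : Continuous fun z => (u z : ℂ) := continuous_subtype_val.comp hu
  have hf : Continuous f := by fun_prop
  have hf0 : ∀ z, f z ≠ 0 := by
    intro z hz
    have h1 : (Real.exp (d z) : ℂ) * u z = 1 := (sub_eq_zero.1 hz).symm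
    have h2 := congrArg norm h1
    rw [norm_mul, Circle.norm_coe, mul_one, norm_one, Complex.norm_real, Real.norm_eq_abs,
      abs_of_pos (Real.exp_pos _), Real.exp_eq_one_iff] at h2
    rw [h2, Real.exp_zero, Complex.ofReal_one, one_mul] at h1
    exact hd0 z (Circle.coe_injective h1) h2
  have key : ∀ c ∈ P.attractionDiagram,
      P.track c.1 = P.puppyPos c.2 + (σ⁻¹ * P.offset c) • (σ • (Complex.I * P.puppyDir c.2)) := by
    intro c hc
    rw [smul_smul, mul_right_comm, inv_mul_cancel₀ hσ, one_mul]
    exact track_eq_of_mem hc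
  -- With the human of `a` at a farthest point, no configuration of `C'` over the same puppy
  -- parameter is farther out, since `a`'s human would then lie strictly between the puppy and the
  -- other human.
  have h1 : HasLog fun z : C' => f (⟨a, ha⟩, z) := by
    refine HasLog.of_mem_slitPlane (hf.comp (continuous_const.prodMk continuous_id)) fun z => ?_
    refine one_sub_exp_mul_mem_slitPlane fun hz => ?_
    have hy : a.2 = z.1.2 := hu1 _ hz
    by_contra! hle
    have hlt' := lt_of_le_of_ne hle (hd0 _ hz).symm
    refine not_strictly_between hx hσ (hpos a ha) (sub_pos.1 hlt') (y := a.2)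
      (a := P.collapse a.2) (b := z.1.1) ?_ (key a (h.subset ha)) ?_
    · rw [zero_smul, add_zero, track_collapse]
    · rw [hy]
      exact key z.1 (h'.subset z.2)
  have h2 := HasLog.of_preconnected hf hf0 (b := ⟨c₀, hc₀⟩) h1
  have hcont : Continuous fun z : C' => ((⟨c₀, hc₀⟩, z) : C × C') :=
    continuous_const.prodMk continuous_id
  have h3 : HasLog fun z : C' =>
      1 - (Real.exp (-d (⟨c₀, hc₀⟩, z)) : ℂ) * ((u (⟨c₀, hc₀⟩, z))⁻¹ : Circle) := by
    refine HasLog.of_mem_slitPlane ?_ fun z => one_sub_exp_mul_mem_slitPlane fun hz => ?_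
    · have e1 := hd.comp hcont
      have e2 : Continuous fun z : C' => (((u (⟨c₀, hc₀⟩, z))⁻¹ : Circle) : ℂ) :=
        continuous_subtype_val.comp (hu.comp hcont).inv
      simp only [Function.comp_def] at e1
      fun_prop
    · have := lt_of_le_of_ne (sub_nonneg.2 (hmin z z.2)) (hd0 _ (inv_eq_one.1 hz)).symm
      exact neg_lt_zero.2 this
  have h4 : HasLog fun z : C' => (Real.exp (-d (⟨c₀, hc₀⟩, z)) : ℂ) := by
    refine HasLog.of_mem_slitPlane ?_ fun z => Complex.ofReal_mem_slitPlane.2 (Real.exp_pos _)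
    have e1 := hd.comp hcont
    simp only [Function.comp_def] at e1
    fun_prop
  have h5 : HasLog fun _ : C' => -(AddCircle.toCircle c₀.2 : ℂ) :=
    HasLog.const (neg_ne_zero.2 (Circle.coe_ne_zero _))
  -- As 1 − e^d·u = −e^d·u·(1 − e^(−d)·u⁻¹) and the last factor has a logarithm by the choice of
  -- `c₀`, so does `u`, and with it the puppy's parameter along `C'`.
  refine hlog' ((((h2.div h3).mul h4).mul h5).congr fun z => ?_)
  have h3z : 1 - (Real.exp (-d (⟨c₀, hc₀⟩, z)) : ℂ) * ((u (⟨c₀, hc₀⟩, z))⁻¹ : Circle) ≠ 0 := by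
    obtain ⟨g, -, hg⟩ := h3
    exact fun h0 => Complex.exp_ne_zero _ ((hg z).trans h0)
  have hyz : (AddCircle.toCircle z.1.2 : ℂ) =
      u (⟨c₀, hc₀⟩, z) * (AddCircle.toCircle c₀.2 : ℂ) := by
    rw [← Circle.coe_mul, ← AddCircle.toCircle_add, sub_add_cancel]
  have hE : (Real.exp (-d (⟨c₀, hc₀⟩, z)) : ℂ) * Real.exp (d (⟨c₀, hc₀⟩, z)) = 1 := by
    rw [← Complex.ofReal_mul, ← Real.exp_add, neg_add_cancel, Real.exp_zero, Complex.ofReal_one]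
  have hU : (((u (⟨c₀, hc₀⟩, z))⁻¹ : Circle) : ℂ) * u (⟨c₀, hc₀⟩, z) = 1 := by
    rw [← Circle.coe_mul, inv_mul_cancel, Circle.coe_one]
  rw [hyz]
  rw [div_mul_eq_mul_div, div_mul_eq_mul_div, div_eq_iff h3z]
  simp only [f]
  linear_combination (AddCircle.toCircle c₀.2 : ℂ) * u (⟨c₀, hc₀⟩, z) * hE +
    (AddCircle.toCircle c₀.2 : ℂ) * Real.exp (-d (⟨c₀, hc₀⟩, z)) * hU

/-- Along at most one critical cycle other than the diagonal, the puppy winds around. -/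
theorem eq_of_not_hasLog (hlt : ∀ i, |P.turn i| < Real.pi / 2) (h : P.IsOffDiagonalCycle C)
    (h' : P.IsOffDiagonalCycle C')
    (hlog : ¬ HasLog fun c : C => (AddCircle.toCircle c.1.2 : ℂ))
    (hlog' : ¬ HasLog fun c : C' => (AddCircle.toCircle c.1.2 : ℂ)) : C = C' := by
  by_contra hne
  obtain ⟨x, hx⟩ := P.exists_farthest
  obtain ⟨y, rfl⟩ := P.collapse_surjective x
  obtain ⟨a, ha, hay⟩ := exists_snd_eq hlog y
  obtain ⟨b, hb, hby⟩ := exists_snd_eq hlog' y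
  have ha0 := offset_ne_zero (h.subset ha) (h.notMem_diagonal hlt ha)
  have hb0 := offset_ne_zero (h'.subset hb) (h'.notMem_diagonal hlt hb)
  have hapos := h.mul_offset_pos hlt (inv_ne_zero ha0) ha
    (by rw [inv_mul_cancel₀ ha0]; exact one_pos)
  -- With the puppy at the farthest point, humans on opposite sides would have that point strictly
  -- between them. Dividing by the offset of `a` makes its side the positive one.
  have hbpos := h'.mul_offset_pos hlt (inv_ne_zero ha0) hb (by
    by_contra! hle
    have hlt' := lt_of_le_of_ne hle (mul_ne_zero (inv_ne_zero ha0) hb0)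
    refine not_strictly_between hx ha0 hlt' one_pos (y := y) (a := b.1) (b := a.1) ?_ ?_ ?_
    · rw [smul_smul, mul_right_comm, inv_mul_cancel₀ ha0, one_mul, ← hby]
      exact track_eq_of_mem (h'.subset hb)
    · rw [zero_smul, add_zero, track_collapse]
    · rw [one_smul, ← hay]
      exact track_eq_of_mem (h.subset ha))
  have hcont : Continuous fun c => (P.offset a)⁻¹ * P.offset c :=
    continuous_const.mul P.continuous_offset
  obtain ⟨c, hc, hcmin⟩ := h.isCompact.exists_isMinOn h.nonempty hcont.continuousOn
  obtain ⟨c', hc', hcmin'⟩ := h'.isCompact.exists_isMinOn h'.nonempty hcont.continuousOn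
  -- Whichever cycle comes closest to the puppy plays the role of `C` above.
  rcases le_total ((P.offset a)⁻¹ * P.offset c) ((P.offset a)⁻¹ * P.offset c') with hle | hle
  · exact h.false_of_offset_le hlt h' hne hlog hlog' ha0 hapos hc fun z hz =>
      hle.trans (hcmin' hz)
  · exact h'.false_of_offset_le hlt h (Ne.symm hne) hlog' hlog ha0 hbpos hc' fun z hz =>
      hle.trans (hcmin hz)

end IsOffDiagonalCycle

end SimplePolygon

end

theorem mainTheorem6 {n : ℕ} [NeZero n] (P : SimplePolygon n)
    (hacute : P.NoAcuteVertexAngle) (hright : P.NoRightAngle) :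
    (∀ C : Set P.Torus, P.IsCriticalCycle C → IsSimpleClosedCurve C) ∧
      {C : Set P.Torus | P.IsCriticalCycle C ∧ IsEssentialCurve C}.ncard = 2 := by
  have hlt := SimplePolygon.abs_turn_lt hacute hright
  have hess : ∀ {C : Set P.Torus}, P.IsOffDiagonalCycle C →
      (IsEssentialCurve C ↔ ¬ HasLog fun c : C => (AddCircle.toCircle c.1.2 : ℂ)) := fun h =>
    SimplePolygon.isEssentialCurve_iff (h.isSimpleClosedCurve hlt hright)
      fun c hc => h.notMem_diagonal hlt hc
  constructor
  · intro C hC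
    rcases hC.eq_diagonal_or hlt with rfl | h
    · exact P.isSimpleClosedCurve_diagonal
    · exact h.isSimpleClosedCurve hlt hright
  · obtain ⟨C, hC, hlog⟩ := SimplePolygon.exists_isOffDiagonalCycle_not_hasLog hlt hright
    have hset : {C : Set P.Torus | P.IsCriticalCycle C ∧ IsEssentialCurve C} =
        {P.diagonal, C} := by
      ext D
      constructor
      · rintro ⟨hD, hDess⟩
        rcases hD.eq_diagonal_or hlt with rfl | h
        · exact .inl rfl
        · exact .inr (h.eq_of_not_hasLog hlt hC ((hess h).1 hDess) hlog)
      · rintro (rfl | rfl)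
        · exact ⟨SimplePolygon.isCriticalCycle_diagonal hlt, P.isEssentialCurve_diagonal⟩
        · exact ⟨hC.isCriticalCycle, (hess hC).2 hlog⟩
    rw [hset, Set.ncard_pair]
    rintro rfl
    obtain ⟨c, hc⟩ := hC.nonempty
    exact hC.notMem_diagonal hlt hc hc
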